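/- Let $\mathcal G=(V,E)$ be a finite simple connected undirected graph with $n$ nodes and $m$ edges, with adjacency matrix $A$, degree vector $d$ and $D=\operatorname{diag}(d)$. Fix a node $v\in V$ and a real $\epsilon>0$. Let $\mathcal L=D^{-1/2}(D-A)D^{-1/2}$ be the normalized Laplacian and $P=D^{-1}A$ the transition matrix of the simple random walk; $\mathcal L_v$ and $P_v$ denote these matrices with the row and the column of $v$ deleted, $\lambda$ denotes the largest absolute value of an eigenvalue of $P_v$, and $\|d_{-v}\|_2$ the Euclidean norm of $d$ with the entry of $v$ removed. Wilson's algorithm with root $v$ starts with the tree consisting of $v$ alone and processes the nodes of $V\setminus\{v\}$ in a fixed arbitrary order. From each node in turn it runs a simple random walk until the walk reaches a node of the current tree (no step is made if the starting node is already in the tree), and then adds the nodes and edges of the chronological loop-erasure of this walk to the tree. All random choices are independent. Sample $l\ge 1$ independent rooted spanning trees in this way. For $u\neq v$ let $\tilde t_{ui}$ be the number of visits to $u$ in the $i$-th sample, that is, the total number of times at which one of the walks is at $u$ before it reaches the current tree, starting positions included, and let $\tilde{\mathbf t}_u=\frac1l\sum_{i=1}^{l}\tilde t_{ui}$. If $$l\;\ge\;2\,\epsilon^{-2}\,\log(2n)\,\frac{\log^2\!\left(\dfrac{m}{n\sqrt{n-1}\,\|d_{-v}\|_2}\right)}{\log^2(\lambda)}$$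 (the right-hand side being read as $0$ if $\lambda=0$), then for every node $u\neq v$ $$\Pr\left(\left|(\mathcal L_v^{-1})_{uu}-\tilde{\mathbf t}_u\right|\ge\frac{\epsilon}{2}\right)\le\frac2n .$$ -/

import Mathlib

namespace WilsonEstimator

open MeasureTheory ProbabilityTheory
open scoped ENNReal

noncomputable section

/-! ### Matrices of a graph -/

section Graph

variable {V : Type*} [Fintype V] [DecidableEq V] (G : SimpleGraph V) [DecidableRel G.Adj]

/-- The normalized Laplacian `D^{-1/2} L D^{-1/2}`, where `L = D - A`. -/
def normLaplacian : Matrix V V ℝ :=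
  Matrix.diagonal (fun x => (√(G.degree x : ℝ))⁻¹) * G.lapMatrix ℝ *
    Matrix.diagonal (fun x => (√(G.degree x : ℝ))⁻¹)

/-- The transition matrix `D^{-1} A` of the simple random walk. -/
def transition : Matrix V V ℝ :=
  Matrix.diagonal (fun x => (G.degree x : ℝ)⁻¹) * G.adjMatrix ℝ

/-- The submatrix obtained by deleting the row and the column of `v`. -/
def deleteNode {W : Type*} (M : Matrix W W ℝ) (v : W) :
    Matrix {x : W // x ≠ v} {x : W // x ≠ v} ℝ :=
  M.submatrix Subtype.val Subtype.val

/-- The largest absolute value of an eigenvalue of the transition matrix with the row and the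
column of `v` deleted. That matrix is similar to a symmetric real one, so all its eigenvalues
are real. -/
def trapEigenvalue (v : V) : ℝ :=
  sSup ((fun x : ℝ => |x|) '' spectrum ℝ (deleteNode (transition G) v))

/-- The Euclidean norm of the degree vector with the entry of `v` removed. -/
def degreeNorm (v : V) : ℝ :=
  ‖(WithLp.toLp 2 (fun x : {x : V // x ≠ v} => (G.degree (x : V) : ℝ)) :
    EuclideanSpace ℝ {x : V // x ≠ v})‖

end Graph

/-! ### Wilson's algorithm

The randomness is a table `r : V → ℕ → V → V`: in the walk launched at `a`, if the walker is at
`w` after `k` steps, then its next position is `r a k w`. -/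

section Algorithm

variable {V : Type*} [DecidableEq V]

/-- The position after `k` steps of a walk launched at `a`. -/
def walk (r : ℕ → V → V) (a : V) : ℕ → V
  | 0 => a
  | k + 1 => r k (walk r a k)

/-- The first time at which the walk launched at `a` is in `S`
(`0` on the event, negligible below, that it never is). -/
def hitTime (r : ℕ → V → V) (a : V) (S : Finset V) : ℕ :=
  sInf {k | walk r a k ∈ S}

/-- Chronological loop-erasure: keep the first vertex, resume right after its last occurrence,
and repeat. -/
def loopErase : List V → List V
  | [] => []
  | a :: t => a :: loopErase (t.rtakeWhile (fun x => decide (x ≠ a)))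
termination_by t => t.length
decreasing_by
  have h := (List.rtakeWhile_suffix (fun x => decide (x ≠ a)) t).length_le
  simp only [List.length_cons]
  omega

/-- The state of the algorithm between two walks: the nodes and the edges of the current tree
(an edge is directed towards the root), and the number of visits to each node so far. -/
structure State (V : Type*) where
  nodes : Finset V
  edges : Finset (V × V)
  visits : V → ℕ

/-- The tree consisting of the root only. -/
def initState (v : V) : State V where
  nodes := {v}
  edges := ∅
  visits := fun _ => 0

/-- Launch a walk at `a`, stop it when it reaches the tree, and add its loop-erasure to the tree.
All positions of the walk before it reaches the tree count as visits, the launching one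
included. -/
def addBranch (r : V → ℕ → V → V) (s : State V) (a : V) : State V :=
  let τ := hitTime (r a) a s.nodes
  let path := loopErase ((List.range (τ + 1)).map (walk (r a) a))
  { nodes := s.nodes ∪ path.toFinset
    edges := s.edges ∪ (path.zip path.tail).toFinset
    visits := fun x => s.visits x + ((Finset.range τ).filter (fun k => walk (r a) a k = x)).card }

/-- Wilson's algorithm with root `v`, processing the nodes in the given order. -/
def wilson (r : V → ℕ → V → V) (v : V) (order : List V) : State V :=
  order.foldl (addBranch r) (initState v)

end Algorithm

/-! ### Independent uniform neighbours -/

/-- All `R i a k w` are independent, and `R i a k w` is a uniformly distributed neighbour of `w`.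
(The index `i` is that of the run, the other ones are as above.) -/
structure IsUniformNeighborTable {V Ω ι : Type*} [Fintype V] [MeasurableSpace V]
    [MeasurableSpace Ω] (G : SimpleGraph V) [DecidableRel G.Adj] (P : Measure Ω)
    (R : ι → V → ℕ → V → Ω → V) : Prop where
  measurable : ∀ i a k w, Measurable (R i a k w)
  uniform : ∀ i a k w x,
    P {ω | R i a k w ω = x} = if G.Adj w x then (G.degree w : ℝ≥0∞)⁻¹ else 0
  indep : iIndepFun (fun j : ι × V × ℕ × V => R j.1 j.2.1 j.2.2.1 j.2.2.2) P

/-- The average over `l` runs of Wilson's algorithm of the number of visits to `u`. -/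
def averageVisits {V Ω : Type*} [DecidableEq V] {l : ℕ} (R : Fin l → V → ℕ → V → Ω → V)
    (v : V) (order : List V) (u : V) (ω : Ω) : ℝ :=
  (∑ i : Fin l, ((wilson (fun a k w => R i a k w ω) v order).visits u : ℝ)) / l

end

end WilsonEstimator

namespace WilsonEstimator

open MeasureTheory ProbabilityTheory
open scoped ENNReal

noncomputable section

/-! ### Sums over killed paths -/

section PathSum

variable {V : Type*} [Fintype V] [DecidableEq V]

/-! Let `g` be the Green function at `u` of the simple random walk killed at `v`. The normalized
Laplacian is the identity minus a conjugate of the transition matrix by `D^{1/2}`, so `g` is also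
the diagonal entry of the inverse. The number of visits to `u` in a run of Wilson's algorithm is
geometric on {1, 2, ...} with mean `g`, whatever the order of the nodes. The estimator is thus an
average of `l` i.i.d. geometric variables, and concentration remains to be shown.

Law. Let F(C) be the generating function of the future visits to `u` when the tree has node set C
(`visitGen`). Cutting a walk at the last visit to its starting point makes loop-erasure recursive
and splits off a Green function (`tsum_pathSum_lastExit`). By Cramer's rule Green functions are
quotients of determinants, so the explicit quotient taken for F obeys a one-point relation
(`greenSum_mul_visitGen_insert`) and is preserved on average when a whole branch is added
(`tsum_pathSum_loopErase`). Induction over the launching nodes (`lintegral_pow_visits`) gives the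
law.

Parameters. A quadratic form argument yields g(1 - λ) ≤ 1, so the failure probability exp(-b) = 1 -
1/g is at most λ and b ≥ |log λ| (`greenMatrix_spectral_bound`). By Cauchy–Schwarz for the degrees,
the logarithmic factor K exceeds log n unless every edge meets `v`; in that case g = 1 and the
estimator is almost surely exact. With c² = K² log(2n)/2 the hypothesis on `l` becomes c² ≤ l (ε/2)²
b².

Concentration. Rescaled by b, a geometric variable is no more dispersed than an exponential one,
both in variance (`IsGeometric.variance_le`) and in centred moment generating function
(`geometric_mgf_le`). The bound is trivial for n = 2, Chebyshev suffices for 3 ≤ n < 64, and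
Chernoff for n ≥ 64. -/

/-- The sum of `Φ` over all paths with `n` steps that start at `y`, avoid `C` before their last
position and end in `S`, weighted by the product of the `p`-weights of their steps. -/
def pathSum (p : V → V → ℝ≥0∞) (C S : Finset V) : ℕ → V → (List V → ℝ≥0∞) → ℝ≥0∞
  | 0, y, Φ => if y ∈ S then Φ [y] else 0
  | n + 1, y, Φ => if y ∈ C then 0 else ∑ x, p y x * pathSum p C S n x (fun w => Φ (y :: w))

variable {p q : V → V → ℝ≥0∞} {C S : Finset V}

theorem pathSum_congr {Φ Ψ : List V → ℝ≥0∞} (n : ℕ) (y : V)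
    (h : ∀ w, Φ (y :: w) = Ψ (y :: w)) : pathSum p C S n y Φ = pathSum p C S n y Ψ := by
  induction n generalizing y Φ Ψ with
  | zero => simp [pathSum, h]
  | succ n ih =>
    simp only [pathSum]
    split_ifs
    · rfl
    · exact Finset.sum_congr rfl fun x _ => by
        rw [ih (Φ := fun w => Φ (y :: w)) (Ψ := fun w => Ψ (y :: w)) x (fun w => h (x :: w))]

theorem pathSum_mono {Φ Ψ : List V → ℝ≥0∞} (hpq : ∀ x y, p x y ≤ q x y) (n : ℕ) (y : V)
    (h : ∀ w, Φ w ≤ Ψ w) : pathSum p C S n y Φ ≤ pathSum q C S n y Ψ := by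
  induction n generalizing y Φ Ψ with
  | zero => simp only [pathSum]; split_ifs <;> simp [h]
  | succ n ih =>
    simp only [pathSum]
    split_ifs
    · rfl
    · exact Finset.sum_le_sum fun x _ => mul_le_mul' (hpq _ _) (ih x (fun w => h (y :: w)))

theorem pathSum_const_mul (c : ℝ≥0∞) (Φ : List V → ℝ≥0∞) (n : ℕ) (y : V) :
    pathSum p C S n y (fun w => c * Φ w) = c * pathSum p C S n y Φ := by
  induction n generalizing y Φ with
  | zero => simp [pathSum]
  | succ n ih =>
    simp only [pathSum, ih]
    split_ifs
    · simp
    · rw [Finset.mul_sum]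
      exact Finset.sum_congr rfl fun x _ => by ring

theorem pathSum_add (Φ Ψ : List V → ℝ≥0∞) (n : ℕ) (y : V) :
    pathSum p C S n y (fun w => Φ w + Ψ w) = pathSum p C S n y Φ + pathSum p C S n y Ψ := by
  induction n generalizing y Φ Ψ with
  | zero => simp only [pathSum]; split_ifs <;> simp
  | succ n ih =>
    simp only [pathSum, ih]
    split_ifs
    · simp
    · rw [← Finset.sum_add_distrib]
      exact Finset.sum_congr rfl fun x _ => by ring

theorem pathSum_zero_fun (n : ℕ) (y : V) : pathSum p C S n y (fun _ => 0) = 0 := by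
  simpa using pathSum_const_mul (p := p) (C := C) (S := S) 0 (fun _ => 0) n y

/-- Paths that avoid `a` are the paths killed at `a`. -/
theorem pathSum_of_notMem {a : V} (haS : a ∉ S) (Ψ : List V → ℝ≥0∞) (n : ℕ) (y : V) :
    pathSum p C S n y (fun w => if a ∈ w then 0 else Ψ w) = pathSum p (insert a C) S n y Ψ := by
  induction n generalizing y Ψ with
  | zero =>
    simp only [pathSum, List.mem_singleton]
    split_ifs with h1 h2
    · exact absurd (h2 ▸ h1) haS
    · rfl
    · rfl
  | succ n ih =>
    simp only [pathSum, Finset.mem_insert, List.mem_cons]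
    by_cases hya : y = a
    · simp [hya, pathSum_zero_fun]
    · have : ¬ a = y := fun h => hya h.symm
      simp only [hya, this, false_or, ih]

/-- The paths through `a`, with a weight that depends on the part after the last visit to `a`:
first-step recursion. -/
theorem pathSum_lastExit_succ {a : V} (haC : a ∉ C) (haS : a ∉ S) (Ψ : List V → ℝ≥0∞) (n : ℕ)
    (y : V) :
    pathSum p C S (n + 1) y
        (fun w => if a ∈ w then Ψ (w.rtakeWhile (fun x => decide (x ≠ a))) else 0) =
      (if y ∈ C then 0 else ∑ x, p y x * pathSum p C S n x
        (fun w => if a ∈ w then Ψ (w.rtakeWhile (fun x => decide (x ≠ a))) else 0)) +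
      if y = a then ∑ x, p a x * pathSum p (insert a C) S n x Ψ else 0 := by
  have key : ∀ w : List V, a ∈ w →
      (y :: w).rtakeWhile (fun x => decide (x ≠ a)) = w.rtakeWhile (fun x => decide (x ≠ a)) := by
    intro w hw
    induction w using List.reverseRecOn with
    | nil => simp at hw
    | append_singleton w b ih =>
      rw [← List.cons_append]
      by_cases hb : b = a
      · rw [List.rtakeWhile_concat_neg, List.rtakeWhile_concat_neg] <;> simp [hb]
      · rw [List.rtakeWhile_concat_pos, List.rtakeWhile_concat_pos, ih] <;> simp_all
        tauto
  have key2 : ∀ w : List V, a ∉ w →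
      (a :: w).rtakeWhile (fun x => decide (x ≠ a)) = w := by
    intro w hw
    induction w using List.reverseRecOn with
    | nil => simp [List.rtakeWhile]
    | append_singleton w b ih =>
      rw [← List.cons_append]
      rw [List.rtakeWhile_concat_pos, ih] <;> simp_all
      tauto
  simp only [pathSum]
  by_cases hya : y = a
  · subst hya
    simp only [haC, if_false, if_true, List.mem_cons, true_or]
    rw [← Finset.sum_add_distrib]
    refine Finset.sum_congr rfl fun x _ => ?_
    rw [← mul_add, ← pathSum_of_notMem haS, ← pathSum_add]
    congr 1
    -- Either the rest of the path returns to `a`, and the last visit lies there, or it avoids `a`,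
    -- and it is a path killed at `a`.
    refine pathSum_congr _ _ fun w => ?_
    split_ifs with h
    · rw [key _ h, add_zero]
    · rw [key2 _ h, zero_add]
  · have : ¬ a = y := fun h => hya h.symm
    simp only [hya, if_false, add_zero, List.mem_cons, this, false_or]
    split_ifs
    · rfl
    · refine Finset.sum_congr rfl fun x _ => ?_
      congr 1
      refine pathSum_congr _ _ fun w => ?_
      split_ifs with h
      · rw [key _ h]
      · rfl

/-- A path through `a` splits uniquely into a path ending at its last visit to `a`, one step out of
`a`, and a path avoiding `a`. The middle step accounts for the difference between `n + 1` and `n`.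
-/
theorem pathSum_lastExit {a : V} (haC : a ∉ C) (haS : a ∉ S) (Ψ : List V → ℝ≥0∞) (n : ℕ)
    (y : V) :
    pathSum p C S (n + 1) y
        (fun w => if a ∈ w then Ψ (w.rtakeWhile (fun x => decide (x ≠ a))) else 0) =
      ∑ k ∈ Finset.HasAntidiagonal.antidiagonal n, pathSum p C {a} k.1 y (fun _ => 1) *
        ∑ x, p a x * pathSum p (insert a C) S k.2 x Ψ := by
  induction n generalizing y with
  | zero =>
    rw [pathSum_lastExit_succ haC haS]
    have : ∀ x, pathSum p C S 0 x
        (fun w => if a ∈ w then Ψ (w.rtakeWhile (fun x => decide (x ≠ a))) else 0) = 0 := by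
      intro x
      simp only [pathSum, List.mem_singleton]
      split_ifs with h1 h2
      · exact absurd (h2 ▸ h1) haS
      · rfl
      · rfl
    simp only [this]
    simp [pathSum]
  | succ n ih =>
    rw [pathSum_lastExit_succ haC haS]
    simp only [ih]
    rw [Finset.Nat.antidiagonal_succ, Finset.sum_cons, add_comm, Finset.sum_map]
    congr 1
    · simp [pathSum]
    · simp only [Function.Embedding.prodMap, Function.Embedding.coeFn_mk, Prod.map]
      simp only [pathSum, Function.Embedding.refl_apply]
      split_ifs
      · simp
      · simp_rw [Finset.mul_sum (Finset.HasAntidiagonal.antidiagonal n)]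
        rw [Finset.sum_comm]
        refine Finset.sum_congr rfl fun k _ => ?_
        rw [Finset.sum_mul]
        exact Finset.sum_congr rfl fun x _ => by simp [mul_assoc]

theorem tsum_antidiagonal_mul (f g : ℕ → ℝ≥0∞) :
    ∑' n, ∑ k ∈ Finset.HasAntidiagonal.antidiagonal n, f k.1 * g k.2 = (∑' n, f n) * ∑' n, g n := by
  simp_rw [← ENNReal.tsum_mul_right, ← ENNReal.tsum_mul_left]
  rw [← ENNReal.tsum_prod (f := fun a b => f a * g b),
    ← Finset.HasAntidiagonal.sigmaAntidiagonalEquivProd.tsum_eq]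
  rw [ENNReal.tsum_sigma']
  refine tsum_congr fun n => ?_
  rw [← Finset.tsum_subtype]
  rfl

/-- The total weight of all paths from `y` to `S` killed in `C`. -/
def greenSum (p : V → V → ℝ≥0∞) (C S : Finset V) (y : V) : ℝ≥0∞ :=
  ∑' n, pathSum p C S n y (fun _ => 1)

/-- First-step analysis; in `ℝ≥0∞` no summability has to be known. -/
theorem greenSum_eq (p : V → V → ℝ≥0∞) (C S : Finset V) (y : V) :
    greenSum p C S y =
      (if y ∈ S then 1 else 0) + if y ∈ C then 0 else ∑ x, p y x * greenSum p C S x := by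
  unfold greenSum
  rw [tsum_eq_zero_add' ENNReal.summable]
  congr 1
  simp only [pathSum]
  split_ifs
  · simp
  · rw [Summable.tsum_finsetSum (fun _ _ => ENNReal.summable)]
    simp_rw [ENNReal.tsum_mul_left]

/-- Decomposition of a path at the last visit to its starting point. -/
theorem tsum_pathSum_lastExit {a : V} (haC : a ∉ C) (haS : a ∉ S) (Ψ : List V → ℝ≥0∞) :
    ∑' n, pathSum p C S n a (fun w => Ψ (w.tail.rtakeWhile (fun x => decide (x ≠ a)))) =
      greenSum p C {a} a * ∑ x, p a x * ∑' n, pathSum p (insert a C) S n x Ψ := by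
  have key2 : ∀ w : List V,
      (a :: w).rtakeWhile (fun x => decide (x ≠ a)) = w.rtakeWhile (fun x => decide (x ≠ a)) := by
    intro w
    induction w using List.reverseRecOn with
    | nil => simp [List.rtakeWhile]
    | append_singleton w b ih =>
      rw [← List.cons_append]
      by_cases hb : b = a
      · rw [List.rtakeWhile_concat_neg, List.rtakeWhile_concat_neg] <;> simp [hb]
      · rw [List.rtakeWhile_concat_pos, List.rtakeWhile_concat_pos, ih] <;> simp_all
  have h0 : ∀ n, pathSum p C S n a
      (fun w => Ψ (w.tail.rtakeWhile (fun x => decide (x ≠ a)))) = pathSum p C S n a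
        (fun w => if a ∈ w then Ψ (w.rtakeWhile (fun x => decide (x ≠ a))) else 0) := by
    intro n
    refine pathSum_congr _ _ fun w => ?_
    simp only [List.tail_cons, List.mem_cons, true_or, if_true]
    rw [key2]
  simp_rw [h0]
  -- The path without steps does not end in `S`, so the index can be shifted before the convolution
  -- is summed.
  rw [tsum_eq_zero_add' ENNReal.summable]
  simp_rw [pathSum_lastExit haC haS]
  rw [tsum_antidiagonal_mul (fun k => pathSum p C {a} k a (fun _ => 1))
    (fun k => ∑ x, p a x * pathSum p (insert a C) S k x Ψ)]
  rw [Summable.tsum_finsetSum (fun _ _ => ENNReal.summable)]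
  simp_rw [ENNReal.tsum_mul_left]
  simp [pathSum, haS, greenSum]

/-- Multiplies the weights of the steps from `u` by `z`. -/
def tilt (z : ℝ≥0∞) (u : V) (p : V → V → ℝ≥0∞) (y x : V) : ℝ≥0∞ :=
  (if y = u then z else 1) * p y x

/-- No step is made from the last position, so the power of `z` counts the visits strictly before
absorption, as Wilson's algorithm does. -/
theorem pathSum_tilt (z : ℝ≥0∞) (u : V) (Φ : List V → ℝ≥0∞) (n : ℕ) (y : V) :
    pathSum (tilt z u p) C S n y Φ =
      pathSum p C S n y (fun w => z ^ (w.dropLast.count u) * Φ w) := by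
  induction n generalizing y Φ with
  | zero => simp [pathSum]
  | succ n ih =>
    simp only [pathSum]
    split_ifs
    · rfl
    · refine Finset.sum_congr rfl fun x _ => ?_
      rw [ih, tilt, mul_assoc, mul_left_comm]
      congr 1
      rw [← pathSum_const_mul]
      refine pathSum_congr _ _ fun w => ?_
      simp only [List.dropLast_cons_cons, List.count_cons (b := y)]
      rw [pow_add]
      by_cases h : y = u <;> simp [h, mul_assoc, mul_left_comm]

/-- If `F` satisfies the one-point relation, then adding the loop-erasure of a `z`-weighted path
to the set of killed points preserves it on average. -/
theorem tsum_pathSum_loopErase {r : V} {z : ℝ≥0∞} {u : V} {F : Finset V → ℝ≥0∞}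
    (hF : ∀ (C : Finset V) (y : V), r ∈ C → y ∉ C →
      greenSum (tilt z u p) C {y} y * ((if y = u then z else 1) * F (insert y C)) =
        greenSum p C {y} y * F C) (C : Finset V) (hr : r ∈ C) (hSC : S ⊆ C) (y : V) :
    ∑' n, pathSum (tilt z u p) C S n y (fun w => F (C ∪ (loopErase w).toFinset)) =
      F C * greenSum p C S y := by
  -- Induction on the number of points not yet killed: the part after the last visit to `y` is a
  -- path killed in `insert y C`.
  induction hk : (Finset.univ \ C).card using Nat.strong_induction_on generalizing C y with
  | _ k ih =>
  by_cases hy : y ∈ C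
  · rw [greenSum_eq, tsum_eq_zero_add' ENNReal.summable]
    simp only [pathSum, hy, if_true, tsum_zero, add_zero]
    have : loopErase [y] = [y] := by
      rw [loopErase]; simp [List.rtakeWhile, loopErase]
    simp [this, Finset.union_eq_left.2 (Finset.singleton_subset_iff.2 hy)]
  · have hyS : y ∉ S := fun h => hy (hSC h)
    have h1 : ∀ n, pathSum (tilt z u p) C S n y (fun w => F (C ∪ (loopErase w).toFinset)) =
        pathSum (tilt z u p) C S n y (fun w =>
          (fun t => F (insert y C ∪ (loopErase t).toFinset))
            (w.tail.rtakeWhile (fun x => decide (x ≠ y)))) := by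
      intro n
      refine pathSum_congr _ _ fun w => ?_
      rw [loopErase]
      simp [Finset.insert_union]
    simp_rw [h1]
    rw [tsum_pathSum_lastExit hy hyS (fun t => F (insert y C ∪ (loopErase t).toFinset))]
    have h2 : ∀ x, ∑' n, pathSum (tilt z u p) (insert y C) S n x
        (fun t => F (insert y C ∪ (loopErase t).toFinset)) =
          F (insert y C) * greenSum p (insert y C) S x := by
      intro x
      refine ih _ ?_ (insert y C) (Finset.mem_insert_of_mem hr)
        (hSC.trans (Finset.subset_insert _ _)) x rfl
      rw [← hk]
      refine Finset.card_lt_card ⟨Finset.sdiff_subset_sdiff le_rfl (Finset.subset_insert _ _), ?_⟩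
      intro h
      have := h (Finset.mem_sdiff.2 ⟨Finset.mem_univ y, hy⟩)
      simp at this
    simp_rw [h2]
    -- The same last-exit decomposition for the untilted weights; `hF` then trades the tilted Green
    -- function for the untilted one.
    have h3 : greenSum p C S y =
        greenSum p C {y} y * ∑ x, p y x * greenSum p (insert y C) S x := by
      have := tsum_pathSum_lastExit (p := p) hy hyS (fun _ => 1)
      simpa [greenSum] using this
    have h4 : ∑ x, tilt z u p y x * (F (insert y C) * greenSum p (insert y C) S x) =
        ((if y = u then z else 1) * F (insert y C)) *
          ∑ x, p y x * greenSum p (insert y C) S x := by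
      rw [Finset.mul_sum]
      exact Finset.sum_congr rfl fun x _ => by rw [tilt]; ring
    rw [h3, h4, ← mul_assoc, hF C y hr hy]
    ring

end PathSum

/-! ### Green functions and determinants -/

section Green

variable {V : Type*} [Fintype V] [DecidableEq V] {p q : V → V → ℝ≥0∞} {C S : Finset V}

theorem greenSum_mono (hqp : ∀ x y, q x y ≤ p x y) (y : V) :
    greenSum q C S y ≤ greenSum p C S y :=
  ENNReal.tsum_le_tsum fun n => pathSum_mono hqp n y fun _ => le_rfl

omit [Fintype V] in
theorem tilt_le {z : ℝ≥0∞} (hz : z ≤ 1) (u : V) (x y : V) : tilt z u p x y ≤ p x y := by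
  unfold tilt
  split_ifs
  · exact mul_le_of_le_one_left' hz
  · simp

/-- First entries into `C` at different times are disjoint events, so their total weight is at most
one. -/
theorem greenSum_self_le_one (hp : ∀ y, ∑ x, p y x ≤ 1) (y : V) : greenSum p C C y ≤ 1 := by
  refine ENNReal.tsum_le_of_sum_range_le fun n => ?_
  induction n generalizing y with
  | zero => simp
  | succ n ih =>
    rw [Finset.sum_range_succ']
    simp only [pathSum]
    split_ifs with h
    · simp
    · rw [Finset.sum_comm, add_zero]
      refine (Finset.sum_le_sum fun x _ => ?_).trans (hp y)
      rw [← Finset.mul_sum]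
      exact mul_le_of_le_one_right' (ih x)

/-- Concatenations at `x` are some of the paths from `y` to `S`. -/
theorem pathSum_mul_pathSum_le (x y : V) (n j : ℕ) :
    pathSum p C {x} n y (fun _ => 1) * pathSum p C S j x (fun _ => 1) ≤
      pathSum p C S (n + j) y (fun _ => 1) := by
  induction n generalizing y with
  | zero =>
    by_cases h : y = x
    · simp [pathSum, h]
    · simp [pathSum, h]
  | succ n ih =>
    rw [Nat.add_right_comm, pathSum, pathSum]
    split_ifs
    · simp
    · rw [Finset.sum_mul]
      exact Finset.sum_le_sum fun k _ => by
        rw [mul_assoc]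
        exact mul_le_mul_right (ih k) _

/-- Extending every path that ends at `x` by an escape to `C` of fixed length `j` turns visits to
`x` into absorptions, of total weight at most one; so the Green function is at most the inverse of
the escape weight. -/
theorem greenSum_singleton_ne_top (hp : ∀ y, ∑ x, p y x ≤ 1) {x : V}
    (hx : ∃ j, pathSum p C C j x (fun _ => 1) ≠ 0) (y : V) : greenSum p C {x} y ≠ ∞ := by
  obtain ⟨j, hj⟩ := hx
  have h : greenSum p C {x} y * pathSum p C C j x (fun _ => 1) ≤ 1 := by
    unfold greenSum
    rw [← ENNReal.tsum_mul_right]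
    refine (ENNReal.tsum_le_tsum fun n => pathSum_mul_pathSum_le x y n j).trans ?_
    refine le_trans ?_ (greenSum_self_le_one (C := C) hp y)
    exact ENNReal.tsum_comp_le_tsum_of_injective (add_left_injective j)
      (fun n => pathSum p C C n y (fun _ => 1))
  intro htop
  rw [htop, ENNReal.top_mul hj] at h
  simp at h

/-- The identity minus the transition matrix with the rows in `C` set to zero. -/
def killedMatrix (q : V → V → ℝ≥0∞) (C : Finset V) : Matrix V V ℝ :=
  fun y x => (1 : Matrix V V ℝ) y x - if y ∈ C then 0 else (q y x).toReal

/-- The matrix of Green functions. -/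
def greenMatrix (q : V → V → ℝ≥0∞) (C : Finset V) : Matrix V V ℝ :=
  fun y x => (greenSum q C {x} y).toReal

theorem killedMatrix_mulVec (hq : ∀ y x, q y x ≠ ∞) (f : V → ℝ≥0∞) (hf : ∀ x, f x ≠ ∞) (y : V) :
    ∑ k, killedMatrix q C y k * (f k).toReal =
      (f y).toReal - (if y ∈ C then 0 else ∑ x, q y x * f x).toReal := by
  simp only [killedMatrix, sub_mul, Finset.sum_sub_distrib]
  congr 1
  · simp [Matrix.one_apply]
  · split_ifs
    · simp
    · rw [ENNReal.toReal_sum fun x _ => ENNReal.mul_ne_top (hq y x) (hf x)]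
      simp

/-- The first-step equation in matrix form. -/
theorem killedMatrix_mul_greenMatrix (hq : ∀ y x, q y x ≠ ∞)
    (hfin : ∀ y x, greenSum q C {x} y ≠ ∞) : killedMatrix q C * greenMatrix q C = 1 := by
  ext y x
  rw [Matrix.mul_apply]
  unfold greenMatrix
  rw [killedMatrix_mulVec hq (fun k => greenSum q C {x} k) (fun k => hfin k x)]
  have h := greenSum_eq q C {x} y
  have hfy := hfin y x
  rw [h] at hfy ⊢
  rw [ENNReal.toReal_add (ne_top_of_le_ne_top hfy le_self_add)
    (ne_top_of_le_ne_top hfy le_add_self), add_sub_cancel_right]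
  by_cases hyx : y = x <;> simp [hyx, Matrix.one_apply]

omit [Fintype V] in
theorem killedMatrix_insert (q : V → V → ℝ≥0∞) (C : Finset V) (y : V) :
    killedMatrix q (insert y C) = (killedMatrix q C).updateRow y (Pi.single y 1) := by
  ext a b
  by_cases h : a = y
  · subst h
    simp [killedMatrix, Matrix.one_apply, Pi.single_apply, eq_comm]
  · simp [killedMatrix, h]

/-- Cramer's rule: killing `y` replaces its row by a unit vector, so the new determinant is a
diagonal entry of the adjugate, that is, the old determinant times the entry of the inverse. -/
theorem det_killedMatrix_insert (hq : ∀ y x, q y x ≠ ∞)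
    (hfin : ∀ y x, greenSum q C {x} y ≠ ∞) (y : V) :
    (killedMatrix q (insert y C)).det = greenMatrix q C y y * (killedMatrix q C).det := by
  have h := killedMatrix_mul_greenMatrix hq hfin
  rw [killedMatrix_insert, ← Matrix.adjugate_apply]
  have h2 : (killedMatrix q C).adjugate =
      (killedMatrix q C).det • greenMatrix q C := by
    calc (killedMatrix q C).adjugate
        = (killedMatrix q C).adjugate * (killedMatrix q C * greenMatrix q C) := by rw [h, mul_one]
      _ = _ := by rw [← mul_assoc, Matrix.adjugate_mul, Matrix.smul_mul, one_mul]
  rw [h2, Matrix.smul_apply, smul_eq_mul, mul_comm]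

theorem one_le_greenMatrix (hfin : ∀ y x, greenSum q C {x} y ≠ ∞) (y : V) :
    1 ≤ greenMatrix q C y y := by
  have h : 1 ≤ greenSum q C {y} y := by
    rw [greenSum_eq]
    simp
  have := ENNReal.toReal_mono (hfin y y) h
  simpa [greenMatrix] using this

/-- The matrix is the identity when all points are killed, and each point added to `C` multiplies
the determinant by a Green function that is at least one. -/
theorem det_killedMatrix_pos {r : V} (hq : ∀ y x, q y x ≠ ∞)
    (hfin : ∀ C : Finset V, r ∈ C → ∀ y x, greenSum q C {x} y ≠ ∞) (C : Finset V) (hr : r ∈ C) :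
    0 < (killedMatrix q C).det := by
  induction hk : (Finset.univ \ C).card generalizing C with
  | zero =>
    have : C = Finset.univ := by
      rw [Finset.card_eq_zero, Finset.sdiff_eq_empty_iff_subset] at hk
      exact Finset.univ_subset_iff.1 hk
    have h1 : killedMatrix q C = 1 := by
      ext a b; simp [killedMatrix, this]
    simp [h1]
  | succ k ih =>
    obtain ⟨y, hy⟩ := Finset.card_pos.1 (by omega : 0 < (Finset.univ \ C).card)
    have hy' : y ∉ C := (Finset.mem_sdiff.1 hy).2
    have h := ih (insert y C) (Finset.mem_insert_of_mem hr) (by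
      rw [Finset.sdiff_insert, Finset.card_erase_of_mem hy]; omega)
    rw [det_killedMatrix_insert hq (hfin C hr)] at h
    exact pos_of_mul_pos_right h (by linarith [one_le_greenMatrix (hfin C hr) y])

/-- The paths are absorbed with probability one. -/
theorem greenSum_self_eq_one (hp : ∀ y, ∑ x, p y x = 1)
    (hfin : ∀ y x, greenSum p C {x} y ≠ ∞) (y : V) : greenSum p C C y = 1 := by
  have hp' : ∀ y x, p y x ≠ ∞ := fun y x => ne_top_of_le_ne_top ENNReal.one_ne_top
    ((Finset.single_le_sum (fun _ _ => zero_le) (Finset.mem_univ x)).trans (hp y).le)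
  have hle := greenSum_self_le_one (C := C) (fun y => (hp y).le)
  have htop : ∀ y, greenSum p C C y ≠ ∞ := fun y => ne_top_of_le_ne_top ENNReal.one_ne_top (hle y)
  -- Absorption probabilities and the constant one solve the same linear system, and its matrix is
  -- invertible.
  have e1 : (killedMatrix p C).mulVec (fun k => (greenSum p C C k).toReal) =
      (killedMatrix p C).mulVec (fun k => (1 : ℝ≥0∞).toReal) := by
    ext a
    simp only [Matrix.mulVec, dotProduct]
    rw [killedMatrix_mulVec hp' _ htop, killedMatrix_mulVec hp' _ (fun _ => ENNReal.one_ne_top)]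
    have h := greenSum_eq p C C a
    have hta := htop a
    rw [h] at hta ⊢
    rw [ENNReal.toReal_add (ne_top_of_le_ne_top hta le_self_add)
      (ne_top_of_le_ne_top hta le_add_self), add_sub_cancel_right]
    by_cases ha : a ∈ C <;> simp [ha, hp]
  have hu := mul_eq_one_comm.1 (killedMatrix_mul_greenMatrix hp' hfin)
  have e2 := congrArg (fun w => (greenMatrix p C).mulVec w) e1
  simp only [Matrix.mulVec_mulVec, hu, Matrix.one_mulVec] at e2
  have := congrFun e2 y
  exact (ENNReal.toReal_eq_toReal_iff' (htop y) ENNReal.one_ne_top).1 this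

/-- The generating function of the number of visits to `u`, as a function of the current tree. -/
def visitGen (p : V → V → ℝ≥0∞) (z : ℝ≥0∞) (u : V) (C : Finset V) : ℝ≥0∞ :=
  ENNReal.ofReal ((if u ∈ C then 1 else z.toReal) * (killedMatrix p C).det /
    (killedMatrix (tilt z u p) C).det)

variable {r u : V} {z : ℝ≥0∞}

/-- A stochastic kernel from which the root can be reached. -/
structure IsAbsorbing (p : V → V → ℝ≥0∞) (r : V) : Prop where
  sum_eq_one : ∀ y, ∑ x, p y x = 1
  greenSum_ne_top : ∀ C : Finset V, r ∈ C → ∀ y x, greenSum p C {x} y ≠ ∞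

theorem IsAbsorbing.ne_top (hp : IsAbsorbing p r) (y x : V) : p y x ≠ ∞ :=
  ne_top_of_le_ne_top ENNReal.one_ne_top
    ((Finset.single_le_sum (fun _ _ => zero_le) (Finset.mem_univ x)).trans (hp.sum_eq_one y).le)

theorem IsAbsorbing.tilt_ne_top (hp : IsAbsorbing p r) (hz : z ≤ 1) (y x : V) :
    tilt z u p y x ≠ ∞ := ne_top_of_le_ne_top (hp.ne_top y x) (tilt_le hz u y x)

theorem IsAbsorbing.greenSum_tilt_ne_top (hp : IsAbsorbing p r) (hz : z ≤ 1) (C : Finset V)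
    (hr : r ∈ C) (y x : V) : greenSum (tilt z u p) C {x} y ≠ ∞ :=
  ne_top_of_le_ne_top (hp.greenSum_ne_top C hr y x) (greenSum_mono (tilt_le hz u) y)

theorem IsAbsorbing.det_pos (hp : IsAbsorbing p r) (hr : r ∈ C) : 0 < (killedMatrix p C).det :=
  det_killedMatrix_pos hp.ne_top hp.greenSum_ne_top C hr

theorem IsAbsorbing.det_tilt_pos (hp : IsAbsorbing p r) (hz : z ≤ 1) (hr : r ∈ C) :
    0 < (killedMatrix (tilt z u p) C).det :=
  det_killedMatrix_pos (hp.tilt_ne_top hz) (hp.greenSum_tilt_ne_top hz) C hr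

omit [Fintype V] in
theorem killedMatrix_tilt_of_mem (hu : u ∈ C) :
    killedMatrix (tilt z u p) C = killedMatrix p C := by
  ext a b
  unfold killedMatrix tilt
  by_cases ha : a ∈ C
  · simp [ha]
  · have : a ≠ u := fun h => ha (h ▸ hu)
    simp [ha, this]

theorem visitGen_of_mem (hp : IsAbsorbing p r) (hr : r ∈ C) (hu : u ∈ C) :
    visitGen p z u C = 1 := by
  rw [visitGen, killedMatrix_tilt_of_mem hu]
  simp [hu, div_self (hp.det_pos hr).ne']

/-- This is the hypothesis of `tsum_pathSum_loopErase`: with both Green functions written as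
quotients of determinants, all factors cancel. -/
theorem greenSum_mul_visitGen_insert (hp : IsAbsorbing p r) (hz : z ≤ 1) (y : V) (hr : r ∈ C)
    (hy : y ∉ C) :
    greenSum (tilt z u p) C {y} y * ((if y = u then z else 1) * visitGen p z u (insert y C)) =
      greenSum p C {y} y * visitGen p z u C := by
  have hzt : z ≠ ∞ := ne_top_of_le_ne_top ENNReal.one_ne_top hz
  have d1 := hp.det_pos hr
  have d2 := hp.det_tilt_pos (u := u) hz hr
  have d3 := hp.det_pos (Finset.mem_insert_of_mem (a := r) (b := y) hr)
  have d4 := hp.det_tilt_pos (u := u) hz (Finset.mem_insert_of_mem (a := r) (b := y) hr)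
  have f1 := hp.greenSum_ne_top C hr y y
  have f2 := hp.greenSum_tilt_ne_top (u := u) hz C hr y y
  have e1 := det_killedMatrix_insert hp.ne_top (hp.greenSum_ne_top C hr) y
  have e2 := det_killedMatrix_insert (hp.tilt_ne_top (u := u) hz)
    (hp.greenSum_tilt_ne_top hz C hr) y
  have n1 : 0 ≤ (if u ∈ C then 1 else z.toReal) := by split_ifs <;> simp
  have n2 : 0 ≤ (if u ∈ insert y C then 1 else z.toReal) := by split_ifs <;> simp
  refine (ENNReal.toReal_eq_toReal_iff' ?_ ?_).1 ?_
  · refine ENNReal.mul_ne_top f2 (ENNReal.mul_ne_top ?_ ENNReal.ofReal_ne_top)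
    split_ifs <;> simp [hzt]
  · exact ENNReal.mul_ne_top f1 ENNReal.ofReal_ne_top
  · have hg2 := one_le_greenMatrix (hp.greenSum_tilt_ne_top (u := u) hz C hr) y
    simp only [visitGen, ENNReal.toReal_mul]
    rw [ENNReal.toReal_ofReal (div_nonneg (mul_nonneg n1 d1.le) d2.le),
      ENNReal.toReal_ofReal (div_nonneg (mul_nonneg n2 d3.le) d4.le), e1, e2]
    change greenMatrix (tilt z u p) C y y * _ = greenMatrix p C y y * _
    have hd2 := d2.ne'
    have hg2' : greenMatrix (tilt z u p) C y y ≠ 0 := by linarith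
    -- When `y = u`, the factor `z` of the step leaving `u` becomes the prefactor that `visitGen`
    -- has only while `u` is outside the tree.
    have hw : (if y = u then z else 1).toReal * (if u ∈ insert y C then 1 else z.toReal) =
        if u ∈ C then 1 else z.toReal := by
      by_cases h : y = u
      · subst h; simp [hy]
      · have : ¬ u = y := fun h' => h h'.symm
        simp [h, this]
    rw [← hw]
    field_simp

/-- The generating function is that of a geometric distribution. -/
theorem visitGen_eq (hp : IsAbsorbing p r) (hz : z ≤ 1) (hr : r ∈ C) (hu : u ∉ C) :
    visitGen p z u C = ENNReal.ofReal (z.toReal / ((1 - z.toReal) * greenMatrix p C u u +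
      z.toReal)) := by
  have hzt : z ≠ ∞ := ne_top_of_le_ne_top ENNReal.one_ne_top hz
  have d1 := hp.det_pos hr
  have e1 := det_killedMatrix_insert hp.ne_top (hp.greenSum_ne_top C hr) u
  -- Tilting changes only row `u`, into a combination of a unit vector and the old row; the
  -- determinant is linear in that row.
  have hrow : killedMatrix (tilt z u p) C = (killedMatrix p C).updateRow u
      ((1 - z.toReal) • Pi.single u 1 + z.toReal • killedMatrix p C u) := by
    ext a b
    by_cases h : a = u
    · subst h
      simp [killedMatrix, tilt, hu, Matrix.one_apply, Pi.single_apply, eq_comm (a := b)]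
      split_ifs <;> ring
    · simp [killedMatrix, tilt, h]
  have hdet : (killedMatrix (tilt z u p) C).det =
      ((1 - z.toReal) * greenMatrix p C u u + z.toReal) * (killedMatrix p C).det := by
    rw [hrow, Matrix.det_updateRow_add, Matrix.det_updateRow_smul, Matrix.det_updateRow_smul,
      Matrix.updateRow_eq_self, ← killedMatrix_insert, e1]
    ring
  rw [visitGen, hdet]
  simp only [hu, if_false]
  rw [mul_div_mul_right _ _ d1.ne']

end Green

/-! ### Walks driven by a random table -/

section Walk

variable {V : Type*} [DecidableEq V]

/-- The positions of the walk launched at `a` during the first `n` steps. -/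
def pathList (r : ℕ → V → V) (n : ℕ) (a : V) : List V :=
  (List.range (n + 1)).map (walk r a)

omit [DecidableEq V] in
theorem walk_succ' (r : ℕ → V → V) (a : V) (k : ℕ) :
    walk r a (k + 1) = walk (fun j => r (j + 1)) (r 0 a) k := by
  induction k with
  | zero => rfl
  | succ k ih => rw [walk, ih, walk]

omit [DecidableEq V] in
theorem pathList_succ (r : ℕ → V → V) (n : ℕ) (a : V) :
    pathList r (n + 1) a = a :: pathList (fun j => r (j + 1)) n (r 0 a) := by
  unfold pathList
  rw [List.range_succ_eq_map, List.map_cons, List.map_map]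
  congr 1
  exact List.map_congr_left fun k _ => walk_succ' r a k

/-- `Φ` of the first `n` steps if the walk avoids `C` before time `n` and is in `S` at time `n`,
and zero otherwise. -/
def stopped (r : ℕ → V → V) (C S : Finset V) (n : ℕ) (a : V) (Φ : List V → ℝ≥0∞) : ℝ≥0∞ :=
  if (∀ k < n, walk r a k ∉ C) ∧ walk r a n ∈ S then Φ (pathList r n a) else 0

theorem stopped_zero (r : ℕ → V → V) (C S : Finset V) (a : V) (Φ : List V → ℝ≥0∞) :
    stopped r C S 0 a Φ = if a ∈ S then Φ [a] else 0 := by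
  simp [stopped, pathList, walk]

theorem stopped_succ (r : ℕ → V → V) (C S : Finset V) (n : ℕ) (a : V) (Φ : List V → ℝ≥0∞) :
    stopped r C S (n + 1) a Φ = if a ∈ C then 0 else
      stopped (fun j => r (j + 1)) C S n (r 0 a) (fun w => Φ (a :: w)) := by
  unfold stopped
  simp only [pathList_succ, walk_succ', Nat.forall_lt_succ_left]
  by_cases ha : a ∈ C <;> simp [ha, walk]

/-- The state after a walk with the given positions. -/
def stateAfter (s : State V) (w : List V) : State V where
  nodes := s.nodes ∪ (loopErase w).toFinset
  edges := s.edges ∪ ((loopErase w).zip (loopErase w).tail).toFinset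
  visits := fun x => s.visits x + w.dropLast.count x

theorem addBranch_eq (r : V → ℕ → V → V) (s : State V) (a : V) :
    addBranch r s a = stateAfter s (pathList (r a) (hitTime (r a) a s.nodes) a) := by
  unfold addBranch stateAfter
  simp only [State.mk.injEq]
  refine ⟨rfl, rfl, ?_⟩
  ext x
  congr 1
  unfold pathList
  rw [List.range_succ, List.map_append, List.map_singleton, List.dropLast_concat]
  generalize hitTime (r a) a s.nodes = n
  induction n with
  | zero => simp
  | succ n ih =>
    rw [Finset.range_add_one, Finset.filter_insert, List.range_succ, List.map_append,
      List.count_append, ← ih]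
    by_cases h : walk (r a) a n = x <;> simp [h]

omit [DecidableEq V] in
theorem hitTime_eq {r : ℕ → V → V} {a : V} {S : Finset V} {n : ℕ}
    (h1 : ∀ k < n, walk r a k ∉ S) (h2 : walk r a n ∈ S) : hitTime r a S = n := by
  unfold hitTime
  refine le_antisymm (Nat.sInf_le h2) (le_csInf ⟨n, h2⟩ fun k hk => ?_)
  by_contra hlt
  exact h1 k (not_le.1 hlt) hk

-- Only the term at the hitting time can be nonzero. A walk that never hits contributes zero, so the
-- default value of `hitTime` plays no role.
open Classical in
theorem tsum_stopped (r : ℕ → V → V) (S : Finset V) (a : V) (Φ : List V → ℝ≥0∞) :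
    ∑' n, stopped r S S n a Φ =
      if ∃ n, walk r a n ∈ S then Φ (pathList r (hitTime r a S) a) else 0 := by
  split_ifs with h
  · have h1 : ∀ k < Nat.find h, walk r a k ∉ S := fun k hk => Nat.find_min h hk
    have h2 := Nat.find_spec h
    rw [tsum_eq_single (Nat.find h), hitTime_eq h1 h2, stopped, if_pos ⟨h1, h2⟩]
    intro n hn
    rw [stopped, if_neg]
    rintro ⟨h3, h4⟩
    exact hn ((hitTime_eq h3 h4).symm.trans (hitTime_eq h1 h2))
  · rw [ENNReal.tsum_eq_zero]
    intro n
    rw [stopped, if_neg]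
    exact fun h' => h ⟨n, h'.2⟩

end Walk

/-! ### Measurability of walks, hitting times and visit counts. -/

section Measurability

variable {Ω : Type*} [MeasurableSpace Ω]

theorem measurable_apply_countable {D β : Type*} [Countable D] [MeasurableSpace D]
    [MeasurableSingletonClass D] [MeasurableSpace β] {Y : Ω → D} (hY : Measurable Y)
    {g : D → Ω → β} (hg : ∀ d, Measurable (g d)) : Measurable fun ω => g (Y ω) ω := by
  intro t ht
  have : (fun ω => g (Y ω) ω) ⁻¹' t = ⋃ d, (Y ⁻¹' {d} ∩ g d ⁻¹' t) := by
    ext ω; simp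
  rw [this]
  exact MeasurableSet.iUnion fun d => (hY (measurableSet_singleton d)).inter (hg d ht)

variable {V : Type*} [Fintype V] [DecidableEq V] [MeasurableSpace V] [DiscreteMeasurableSpace V]

omit [DecidableEq V] in
theorem measurable_walk {ρ : ℕ → V → Ω → V} (hρ : ∀ k w, Measurable (ρ k w)) (a : V) (n : ℕ) :
    Measurable fun ω => walk (fun k w => ρ k w ω) a n := by
  induction n with
  | zero => exact measurable_const
  | succ n ih => exact measurable_apply_countable ih fun w => hρ n w

theorem measurable_hitTime {ρ : ℕ → V → Ω → V} (hρ : ∀ k w, Measurable (ρ k w)) (a : V)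
    (S : Finset V) : Measurable fun ω => hitTime (fun k w => ρ k w ω) a S := by
  have hS : ∀ k, MeasurableSet {ω | walk (fun k w => ρ k w ω) a k ∈ S} := fun k =>
    measurable_walk hρ a k (MeasurableSet.of_discrete (s := (S : Set V)))
  have hfirst : ∀ n, MeasurableSet {ω | (∀ k < n, walk (fun k w => ρ k w ω) a k ∉ S) ∧
      walk (fun k w => ρ k w ω) a n ∈ S} := by
    intro n
    have : {ω | ∀ k < n, walk (fun k w => ρ k w ω) a k ∉ S} =
        ⋂ k, ⋂ (_ : k < n), {ω | walk (fun k w => ρ k w ω) a k ∈ S}ᶜ := by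
      ext ω; simp
    have h2 : MeasurableSet {ω | ∀ k < n, walk (fun k w => ρ k w ω) a k ∉ S} := by
      rw [this]
      exact MeasurableSet.iInter fun k => MeasurableSet.iInter fun _ => (hS k).compl
    exact h2.inter (hS n)
  refine measurable_to_countable' fun n => ?_
  -- The fibre over `0` also contains the event that `S` is never hit, since the infimum of the
  -- empty set is `0`.
  have : (fun ω => hitTime (fun k w => ρ k w ω) a S) ⁻¹' {n} =
      {ω | (∀ k < n, walk (fun k w => ρ k w ω) a k ∉ S) ∧
        walk (fun k w => ρ k w ω) a n ∈ S} ∪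
      (if n = 0 then (⋃ k, {ω | walk (fun k w => ρ k w ω) a k ∈ S})ᶜ else ∅) := by
    ext ω
    by_cases h : ∃ k, walk (fun k w => ρ k w ω) a k ∈ S
    · classical
      have h1 : ∀ k < Nat.find h, walk (fun k w => ρ k w ω) a k ∉ S :=
        fun k hk => Nat.find_min h hk
      have h2 := Nat.find_spec h
      have hno : ω ∉ (if n = 0 then (⋃ k, {ω | walk (fun k w => ρ k w ω) a k ∈ S})ᶜ else ∅) := by
        split_ifs
        · simpa using h
        · simp
      simp only [Set.mem_preimage, Set.mem_singleton_iff, Set.mem_union, hno, or_false,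
        Set.mem_ofPred_eq]
      constructor
      · intro he
        rw [hitTime_eq h1 h2] at he
        rw [← he]
        exact ⟨h1, h2⟩
      · exact fun he => hitTime_eq he.1 he.2
    · have h0 : hitTime (fun k w => ρ k w ω) a S = 0 := by
        unfold hitTime
        have : {k | walk (fun k w => ρ k w ω) a k ∈ S} = ∅ := by
          ext k; simpa using fun hk => h ⟨k, hk⟩
        rw [this, Nat.sInf_empty]
      have hn : ¬ walk (fun k w => ρ k w ω) a n ∈ S := fun hk => h ⟨n, hk⟩
      simp only [Set.mem_preimage, Set.mem_singleton_iff, Set.mem_union, h0, Set.mem_ofPred_eq, hn,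
        and_false, false_or]
      split_ifs with h3
      · simp only [h3, Set.mem_compl_iff, Set.mem_iUnion, Set.mem_ofPred_eq, true_iff]
        exact h
      · simp [eq_comm, h3]
  rw [this]
  refine (hfirst n).union ?_
  split_ifs
  · exact (MeasurableSet.iUnion hS).compl
  · exact MeasurableSet.empty

/-- Measurability is asked only of the walks launched from `order`, so the σ-algebra on `Ω` may be
the one generated by those table entries alone. All independence statements below use this. -/
theorem measurable_visits {R : V → ℕ → V → Ω → V} (u : V) (order : List V)
    (hR : ∀ b ∈ order, ∀ k w, Measurable (R b k w)) (s : State V) :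
    Measurable fun ω => (order.foldl (addBranch (fun a k w => R a k w ω)) s).visits u := by
  induction order generalizing s with
  | nil => simp
  | cons a rest ih =>
    simp only [List.foldl_cons, addBranch_eq]
    let _ : MeasurableSpace (List V) := ⊤
    have hRa := hR a List.mem_cons_self
    have hpath : ∀ n, Measurable fun ω => pathList (fun k w => R a k w ω) n a := by
      intro n
      refine measurable_to_countable' fun w => ?_
      have : (fun ω => pathList (fun k w => R a k w ω) n a) ⁻¹' {w} =
          ⋂ (k : ℕ), {ω | ((List.range (n + 1)).map
            (walk (fun k w => R a k w ω) a))[k]? = w[k]?} := by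
        ext ω
        simp only [Set.mem_preimage, Set.mem_singleton_iff, Set.mem_iInter, Set.mem_ofPred_eq]
        exact List.ext_getElem?_iff
      rw [this]
      refine MeasurableSet.iInter fun k => ?_
      simp only [List.getElem?_map]
      cases (List.range (n + 1))[k]? with
      | none => simp
      | some j =>
        simp only [Option.map_some]
        have := measurable_walk hRa a j
          (MeasurableSet.of_discrete (s := {x : V | some x = w[k]?}))
        exact this
    have hY := measurable_apply_countable (measurable_hitTime hRa a s.nodes) hpath
    exact measurable_apply_countable (g := fun w ω =>
        (rest.foldl (addBranch (fun a k w => R a k w ω)) (stateAfter s w)).visits u) hY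
      fun w => ih (fun b hb => hR b (List.mem_cons_of_mem _ hb)) _

theorem measurable_stopped {ρ : ℕ → V → Ω → V} (hρ : ∀ k w, Measurable (ρ k w))
    (C S : Finset V) {J : List V → Ω → ℝ≥0∞} (hJ : ∀ w, Measurable (J w)) (n : ℕ) (a : V) :
    Measurable fun ω => stopped (fun k w => ρ k w ω) C S n a (fun w => J w ω) := by
  induction n generalizing ρ J a with
  | zero =>
    simp only [stopped_zero]
    split_ifs
    · exact hJ _
    · exact measurable_const
  | succ n ih =>
    simp only [stopped_succ]
    split_ifs
    · exact measurable_const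
    · exact measurable_apply_countable (hρ 0 a)
        (g := fun x ω => stopped (fun j w => ρ (j + 1) w ω) C S n x (fun w => J (a :: w) ω))
        fun x => ih (fun k w => hρ (k + 1) w) (fun w => hJ (a :: w)) x

end Measurability

/-! ### Independence of disjoint blocks of the table, and expectations as path sums. -/

section Independence

variable {Ω : Type*} [MeasurableSpace Ω] {P : Measure Ω} {V : Type*} [MeasurableSpace V]
  {ι : Type*}

/-- The σ-algebra generated by the variables with index in `A`. -/
abbrev generatedBy (X : ι → Ω → V) (A : Set ι) : MeasurableSpace Ω :=
  ⨆ i ∈ A, MeasurableSpace.comap (X i) inferInstance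

omit [MeasurableSpace Ω] in
theorem measurable_generatedBy {X : ι → Ω → V} {A : Set ι} {i : ι} (hi : i ∈ A) :
    Measurable[generatedBy X A] (X i) :=
  measurable_iff_comap_le.2
    (le_iSup₂ (f := fun i (_ : i ∈ A) => MeasurableSpace.comap (X i) inferInstance) i hi)

omit [MeasurableSpace Ω] in
theorem generatedBy_mono (X : ι → Ω → V) {A B : Set ι} (h : A ⊆ B) :
    generatedBy X A ≤ generatedBy X B :=
  biSup_mono fun _ hi => h hi

theorem generatedBy_le {X : ι → Ω → V} (hX : ∀ i, Measurable (X i)) (A : Set ι) :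
    generatedBy X A ≤ ‹MeasurableSpace Ω› :=
  iSup₂_le fun i _ => (hX i).comap_le

theorem indep_generatedBy {X : ι → Ω → V} (hX : ∀ i, Measurable (X i)) (hind : iIndepFun X P)
    {A B : Set ι} (hAB : Disjoint A B) : Indep (generatedBy X A) (generatedBy X B) P :=
  indep_iSup_of_disjoint (fun i => (hX i).comap_le) hind hAB

theorem lintegral_mul_of_disjoint {X : ι → Ω → V} (hX : ∀ i, Measurable (X i))
    (hind : iIndepFun X P) {A B : Set ι} (hAB : Disjoint A B) {f g : Ω → ℝ≥0∞}
    (hf : Measurable[generatedBy X A] f) (hg : Measurable[generatedBy X B] g) :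
    ∫⁻ ω, f ω * g ω ∂P = (∫⁻ ω, f ω ∂P) * ∫⁻ ω, g ω ∂P :=
  lintegral_mul_eq_lintegral_mul_lintegral_of_independent_measurableSpace
    (generatedBy_le hX A) (generatedBy_le hX B) (indep_generatedBy hX hind hAB) hf hg

variable [Fintype V] [DecidableEq V] [DiscreteMeasurableSpace V]

/-- Every step reads a table entry with a new time index, so the first step is independent of the
rest of the walk; `J` reads only entries in `B`, which the walk never uses. -/
theorem lintegral_stopped {X : ι → Ω → V} (hX : ∀ i, Measurable (X i)) (hind : iIndepFun X P)
    {p : V → V → ℝ≥0∞} (e : ℕ → V → ι) (he : ∀ k w k' w', e k w = e k' w' → k = k')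
    (hunif : ∀ k w x, P {ω | X (e k w) ω = x} = p w x) (B : Set ι) (hB : ∀ k w, e k w ∉ B)
    (C S : Finset V) {J : List V → Ω → ℝ≥0∞} (hJ : ∀ w, Measurable[generatedBy X B] (J w))
    (n : ℕ) (a : V) :
    ∫⁻ ω, stopped (fun k w => X (e k w) ω) C S n a (fun w => J w ω) ∂P =
      pathSum p C S n a (fun w => ∫⁻ ω, J w ω ∂P) := by
  induction n generalizing e J a with
  | zero =>
    simp only [stopped_zero, pathSum]
    split_ifs <;> simp
  | succ n ih =>
    simp only [stopped_succ, pathSum]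
    split_ifs
    · simp
    · set f : V → Ω → ℝ≥0∞ := fun x ω =>
        stopped (fun j w => X (e (j + 1) w) ω) C S n x (fun w => J (a :: w) ω) with hf
      set g : V → Ω → ℝ≥0∞ := fun x => Set.indicator {ω | X (e 0 a) ω = x} (fun _ => 1) with hg
      have hset : ∀ x, MeasurableSet[generatedBy X {e 0 a}] {ω | X (e 0 a) ω = x} := fun x =>
        measurable_generatedBy (X := X) (Set.mem_singleton (e 0 a))
          (measurableSet_singleton x)
      have hgm : ∀ x, Measurable[generatedBy X {e 0 a}] (g x) := fun x =>
        (@measurable_const _ _ _ (generatedBy X {e 0 a}) 1).indicator (hset x)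
      have hfm : ∀ x, Measurable[generatedBy X ({j | ∃ k w, e (k + 1) w = j} ∪ B)] (f x) := by
        intro x
        refine @measurable_stopped Ω (generatedBy X ({j | ∃ k w, e (k + 1) w = j} ∪ B)) V _ _ _ _
          (fun j w => X (e (j + 1) w)) ?_ C S (fun w => J (a :: w)) ?_ n x
        · exact fun k w => measurable_generatedBy (Or.inl ⟨k, w, rfl⟩)
        · exact fun w => (hJ (a :: w)).mono (generatedBy_mono X Set.subset_union_right) le_rfl
      have hsum : ∀ ω, stopped (fun j w => X (e (j + 1) w) ω) C S n (X (e 0 a) ω)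
          (fun w => J (a :: w) ω) = ∑ x, g x ω * f x ω := by
        intro ω
        rw [Finset.sum_eq_single (X (e 0 a) ω)]
        · simp [hg, hf]
        · intro x _ hx
          simp [hg, Ne.symm hx]
        · simp
      have hdisj : Disjoint {e 0 a} ({j | ∃ k w, e (k + 1) w = j} ∪ B) := by
        rw [Set.disjoint_singleton_left]
        rintro (⟨k, w, h⟩ | h)
        · exact absurd (he _ _ _ _ h) (Nat.succ_ne_zero k)
        · exact hB _ _ h
      simp_rw [hsum]
      rw [lintegral_finsetSum (f := fun x ω => g x ω * f x ω) _ fun x _ =>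
        ((hgm x).mono (generatedBy_le hX _) le_rfl).mul ((hfm x).mono (generatedBy_le hX _) le_rfl)]
      refine Finset.sum_congr rfl fun x _ => ?_
      rw [lintegral_mul_of_disjoint hX hind hdisj (hgm x) (hfm x)]
      congr 1
      · rw [hg, lintegral_indicator (generatedBy_le hX _ _ (hset x))]
        simp [hunif]
      · exact ih (fun k w => e (k + 1) w) (fun k w k' w' h => by
          simpa using he _ _ _ _ h) (fun k w x => hunif _ _ _) (fun k w => hB _ _)
          (fun w => hJ (a :: w)) x

/-- The generating function of the number of visits, for a run that continues from any state. -/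
theorem lintegral_pow_visits [IsProbabilityMeasure P] {p : V → V → ℝ≥0∞} {v : V}
    (hp : IsAbsorbing p v)
    {z : ℝ≥0∞} (hz : z ≤ 1) (u : V) {R : V → ℕ → V → Ω → V} (hR : ∀ a k w, Measurable (R a k w))
    (hunif : ∀ a k w x, P {ω | R a k w ω = x} = p w x)
    (hind : iIndepFun (fun j : V × ℕ × V => R j.1 j.2.1 j.2.2) P) (order : List V)
    (hnodup : order.Nodup) (s : State V) (hv : v ∈ s.nodes)
    (hcover : ∀ x, x ∈ s.nodes ∨ x ∈ order) :
    ∫⁻ ω, z ^ ((order.foldl (addBranch (fun a k w => R a k w ω)) s).visits u) ∂P =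
      z ^ (s.visits u) * visitGen p z u s.nodes := by
  have hX : ∀ j : V × ℕ × V, Measurable (R j.1 j.2.1 j.2.2) := fun j => hR _ _ _
  induction order generalizing s with
  | nil =>
    -- Every node is in the tree, hence no visit is left.
    have hu : u ∈ s.nodes := by simpa using hcover u
    simp [visitGen_of_mem hp hv hu]
  | cons a rest ih =>
    obtain ⟨ha, hnd⟩ := List.nodup_cons.1 hnodup
    -- The remaining runs, once the walk from `a` is fixed to be `w`: they read only the entries of
    -- the nodes in `rest`.
    set J : List V → Ω → ℝ≥0∞ := fun w ω =>
      z ^ ((rest.foldl (addBranch (fun a k w => R a k w ω)) (stateAfter s w)).visits u) with hJdef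
    set B : Set (V × ℕ × V) := {j | j.1 ∈ rest} with hB
    set X : V × ℕ × V → Ω → V := fun j => R j.1 j.2.1 j.2.2 with hXdef
    have hJ : ∀ w, Measurable[generatedBy X B] (J w) := by
      intro w
      have h1 := @measurable_visits Ω (generatedBy X B) V _ _ _ _ R u rest
        (fun b hb k w => measurable_generatedBy (X := X) (A := B) (i := (b, k, w)) hb)
        (stateAfter s w)
      exact (@Measurable.of_discrete ℕ ℝ≥0∞ _ _ _ (fun m => z ^ m)).comp h1
    have key : ∀ {J' : List V → Ω → ℝ≥0∞}, (∀ w, Measurable[generatedBy X B] (J' w)) → ∀ n,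
        ∫⁻ ω, stopped (fun k w => R a k w ω) s.nodes s.nodes n a (fun w => J' w ω) ∂P =
          pathSum p s.nodes s.nodes n a (fun w => ∫⁻ ω, J' w ω ∂P) := by
      intro J' hJ' n
      exact lintegral_stopped (X := X) hX hind (fun k w => (a, k, w))
        (fun k w k' w' h => by simp at h; exact h.1) (fun k w x => hunif a k w x) B
        (fun k w => ha) s.nodes s.nodes hJ' n a
    have hmeas : ∀ {J' : List V → Ω → ℝ≥0∞}, (∀ w, Measurable[generatedBy X B] (J' w)) → ∀ n,
        Measurable fun ω => stopped (fun k w => R a k w ω) s.nodes s.nodes n a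
          (fun w => J' w ω) := fun hJ' n =>
      measurable_stopped (fun k w => hR a k w) _ _
        (fun w => (hJ' w).mono (generatedBy_le hX _) le_rfl) n a
    have hhit : ∀ᵐ ω ∂P, ∃ n, walk (fun k w => R a k w ω) a n ∈ s.nodes := by
      have hone : ∀ _ : List V, Measurable[generatedBy X B] (fun _ : Ω => (1 : ℝ≥0∞)) :=
        fun _ => @measurable_const _ _ _ (generatedBy X B) 1
      have hset : MeasurableSet {ω | ∃ n, walk (fun k w => R a k w ω) a n ∈ s.nodes} := by
        simp only [Set.ofPred_exists]
        exact MeasurableSet.iUnion fun n => measurable_walk (fun k w => hR a k w) a n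
          (MeasurableSet.of_discrete (s := (s.nodes : Set V)))
      have h1 : P {ω | ∃ n, walk (fun k w => R a k w ω) a n ∈ s.nodes} = 1 := by
        calc P {ω | ∃ n, walk (fun k w => R a k w ω) a n ∈ s.nodes}
            = ∫⁻ ω, ∑' n, stopped (fun k w => R a k w ω) s.nodes s.nodes n a (fun _ => 1) ∂P := by
              rw [← lintegral_indicator_one hset]
              refine lintegral_congr fun ω => ?_
              rw [tsum_stopped]
              by_cases h : ∃ n, walk (fun k w => R a k w ω) a n ∈ s.nodes
              · rw [if_pos h, Set.indicator_of_mem (by exact h), Pi.one_apply]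
              · rw [if_neg h, Set.indicator_of_notMem (by exact h)]
          _ = 1 := by
              rw [lintegral_tsum fun n => (hmeas hone n).aemeasurable]
              simp_rw [key hone]
              simp only [lintegral_one, measure_univ]
              exact greenSum_self_eq_one hp.sum_eq_one (hp.greenSum_ne_top _ hv) a
      exact (mem_ae_iff_prob_eq_one hset).2 h1
    have hstep : ∫⁻ ω, z ^ (((a :: rest).foldl (addBranch (fun a k w => R a k w ω)) s).visits u) ∂P =
        ∫⁻ ω, ∑' n, stopped (fun k w => R a k w ω) s.nodes s.nodes n a (fun w => J w ω) ∂P := by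
      refine lintegral_congr_ae ?_
      filter_upwards [hhit] with ω hω
      rw [tsum_stopped, if_pos hω, List.foldl_cons, addBranch_eq]
    rw [hstep, lintegral_tsum fun n => (hmeas hJ n).aemeasurable]
    simp_rw [key hJ]
    -- The induction hypothesis evaluates the continuation; the visits made by the present walk are
    -- absorbed into the tilted weights.
    have hval : ∀ n, pathSum p s.nodes s.nodes n a (fun w => ∫⁻ ω, J w ω ∂P) =
        z ^ (s.visits u) * pathSum (tilt z u p) s.nodes s.nodes n a
          (fun w => visitGen p z u (s.nodes ∪ (loopErase w).toFinset)) := by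
      intro n
      rw [pathSum_tilt, ← pathSum_const_mul]
      refine pathSum_congr _ _ fun w => ?_
      rw [hJdef]
      dsimp only
      rw [ih hnd (stateAfter s (a :: w)) (Finset.mem_union_left _ hv)]
      · simp only [stateAfter]
        rw [pow_add, mul_assoc]
      · intro x
        rcases hcover x with h | h
        · exact Or.inl (Finset.mem_union_left _ h)
        · rcases List.mem_cons.1 h with rfl | h
          · refine Or.inl (Finset.mem_union_right _ ?_)
            rw [loopErase]; simp
          · exact Or.inr h
    simp_rw [hval]
    rw [ENNReal.tsum_mul_left, tsum_pathSum_loopErase (r := v)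
      (fun C y hr hy => greenSum_mul_visitGen_insert hp hz y hr hy) s.nodes hv subset_rfl,
      greenSum_self_eq_one hp.sum_eq_one (hp.greenSum_ne_top _ hv), mul_one]

end Independence

/-! ### The number of visits is geometric -/

/-- Uniqueness of power series coefficients: once the lower ones vanish, dividing by `z ^ k` leaves
`c k` plus a tail of order `z`. -/
theorem eq_zero_of_hasSum_mul_pow {c : ℕ → ℝ} {M : ℝ} (hM : ∀ k, |c k| ≤ M)
    (h : ∀ z : ℝ, 0 < z → z < 1 → HasSum (fun k => c k * z ^ k) 0) (k : ℕ) : c k = 0 := by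
  have hM0 : 0 ≤ M := (abs_nonneg _).trans (hM 0)
  induction k using Nat.strong_induction_on with
  | _ k ih =>
  have hbound : ∀ z : ℝ, 0 < z → z < 1 → |c k| ≤ M * (z / (1 - z)) := by
    intro z hz0 hz1
    have h1 := h z hz0 hz1
    have h2 : HasSum (fun j => c (j + (k + 1)) * z ^ (j + (k + 1)))
        (0 - ∑ i ∈ Finset.range (k + 1), c i * z ^ i) :=
      (hasSum_nat_add_iff' (k + 1)).2 h1
    rw [Finset.sum_range_succ, Finset.sum_eq_zero fun i hi => by
      rw [ih i (Finset.mem_range.1 hi), zero_mul], zero_add, zero_sub] at h2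
    have h3 := h2.mul_left ((z ^ k)⁻¹)
    have hzk : z ^ k ≠ 0 := (pow_pos hz0 k).ne'
    have h4 : HasSum (fun j => c (j + (k + 1)) * z ^ (j + 1)) (-c k) := by
      have e1 : (z ^ k)⁻¹ * -(c k * z ^ k) = -c k := by field_simp
      have e2 : (fun j => c (j + (k + 1)) * z ^ (j + 1)) =
          fun j => (z ^ k)⁻¹ * (c (j + (k + 1)) * z ^ (j + (k + 1))) := by
        ext j
        rw [show j + (k + 1) = (j + 1) + k by ring, pow_add z (j + 1) k]
        field_simp
      rw [e2, ← e1]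
      exact h3
    have h5 : HasSum (fun j => M * (z * z ^ j)) (M * (z * (1 - z)⁻¹)) :=
      ((hasSum_geometric_of_lt_one hz0.le hz1).mul_left z).mul_left M
    have h6 : ∀ j, |c (j + (k + 1)) * z ^ (j + 1)| ≤ M * (z * z ^ j) := by
      intro j
      rw [abs_mul, abs_of_pos (pow_pos hz0 (j + 1)), pow_succ']
      exact mul_le_mul_of_nonneg_right (hM _) (by positivity)
    have h7 := tsum_of_norm_bounded (f := fun j => c (j + (k + 1)) * z ^ (j + 1)) h5 h6
    rw [h4.tsum_eq, norm_neg] at h7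
    simpa [div_eq_mul_inv] using h7
  by_contra hc
  have hpos : 0 < |c k| := abs_pos.2 hc
  have hMpos : 0 < M := hpos.trans_le (hM k)
  have hd : 0 < |c k| + 2 * M := by positivity
  -- This `z` satisfies z/(1 - z) = |c k|/(2M), so the bound reads |c k| ≤ |c k|/2.
  have := hbound (|c k| / (|c k| + 2 * M)) (by positivity) (by
    rw [div_lt_one hd]; linarith)
  have he : |c k| / (|c k| + 2 * M) / (1 - |c k| / (|c k| + 2 * M)) = |c k| / (2 * M) := by
    have : 1 - |c k| / (|c k| + 2 * M) = 2 * M / (|c k| + 2 * M) := by field_simp; ring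
    rw [this]
    field_simp
  rw [he] at this
  have h8 : M * (|c k| / (2 * M)) = |c k| / 2 := by field_simp
  linarith

section Law

variable {Ω : Type*} [MeasurableSpace Ω] {P : Measure Ω} [IsProbabilityMeasure P] {N : Ω → ℕ}

omit [IsProbabilityMeasure P] in
theorem hasSum_measureReal_mul_pow (hN : Measurable N) {z c : ℝ} (hz : 0 ≤ z) (hc : 0 ≤ c)
    (h : ∫⁻ ω, ENNReal.ofReal z ^ N ω ∂P = ENNReal.ofReal c) :
    HasSum (fun k => P.real (N ⁻¹' {k}) * z ^ k) c := by
  have h1 : ∫⁻ ω, ENNReal.ofReal z ^ N ω ∂P =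
      ∑' k, ENNReal.ofReal z ^ k * P (N ⁻¹' {k}) := by
    rw [← lintegral_map (f := fun k => ENNReal.ofReal z ^ k) Measurable.of_discrete hN,
      lintegral_countable']
    refine tsum_congr fun k => ?_
    rw [Measure.map_apply hN (measurableSet_singleton k)]
  rw [h1] at h
  have h2 := ENNReal.hasSum_toReal (h.trans_ne ENNReal.ofReal_ne_top)
  rw [← ENNReal.tsum_toReal_eq (fun k => ENNReal.ne_top_of_tsum_ne_top
    (h.trans_ne ENNReal.ofReal_ne_top) k), h, ENNReal.toReal_ofReal hc] at h2
  convert h2 using 1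
  ext k
  rw [ENNReal.toReal_mul, ENNReal.toReal_pow, ENNReal.toReal_ofReal hz, mul_comm]
  rfl

/-- A geometric generating function determines the law. -/
theorem measureReal_eq_of_lintegral_pow (hN : Measurable N) {g : ℝ} (hg : 1 ≤ g)
    (h : ∀ z : ℝ, 0 ≤ z → z ≤ 1 →
      ∫⁻ ω, ENNReal.ofReal z ^ N ω ∂P = ENNReal.ofReal (z / ((1 - z) * g + z))) (k : ℕ) :
    P.real (N ⁻¹' {k}) = if k = 0 then 0 else g⁻¹ * (1 - g⁻¹) ^ (k - 1) := by
  have hg0 : 0 < g := by linarith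
  have hq0 : 0 ≤ 1 - g⁻¹ := by
    have := inv_le_one_of_one_le₀ hg
    linarith
  have hq1 : 1 - g⁻¹ < 1 := by
    have := inv_pos.2 hg0
    linarith
  set b : ℕ → ℝ := fun k => if k = 0 then 0 else g⁻¹ * (1 - g⁻¹) ^ (k - 1) with hb
  have hb0 : ∀ k, 0 ≤ b k := by
    intro k
    simp only [hb]
    split_ifs
    · rfl
    · positivity
  have hb1 : ∀ k, b k ≤ 1 := by
    intro k
    simp only [hb]
    split_ifs
    · exact zero_le_one
    · exact mul_le_one₀ (inv_le_one_of_one_le₀ hg) (by positivity) (pow_le_one₀ hq0 hq1.le)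
  have key : ∀ k, P.real (N ⁻¹' {k}) - b k = 0 := by
    refine eq_zero_of_hasSum_mul_pow (M := 1) (fun k => ?_) fun z hz0 hz1 => ?_
    · have h1 : P.real (N ⁻¹' {k}) ≤ 1 := measureReal_le_one
      have h2 : 0 ≤ P.real (N ⁻¹' {k}) := measureReal_nonneg
      rw [abs_le]
      constructor <;> linarith [hb0 k, hb1 k]
    · have hden : 0 < (1 - z) * g + z := by nlinarith
      have h1 := hasSum_measureReal_mul_pow hN hz0.le (by positivity) (h z hz0.le hz1.le)
      have hqz : (1 - g⁻¹) * z < 1 := by nlinarith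
      have h2 : HasSum (fun k => b k * z ^ k) (z / ((1 - z) * g + z)) := by
        rw [← hasSum_nat_add_iff' 1]
        have h3 := (hasSum_geometric_of_lt_one (mul_nonneg hq0 hz0.le) hqz).mul_left (g⁻¹ * z)
        have e1 : g⁻¹ * z * (1 - (1 - g⁻¹) * z)⁻¹ =
            z / ((1 - z) * g + z) - ∑ i ∈ Finset.range 1, b i * z ^ i := by
          have : 1 - (1 - g⁻¹) * z = ((1 - z) * g + z) * g⁻¹ := by field_simp; ring
          rw [this]
          simp [hb]
          field_simp
        have e2 : (fun k => b (k + 1) * z ^ (k + 1)) =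
            fun k => g⁻¹ * z * ((1 - g⁻¹) * z) ^ k := by
          ext k
          simp only [hb, Nat.add_eq_zero_iff, one_ne_zero, and_false, if_false,
            Nat.add_sub_cancel, mul_pow, pow_succ]
          ring
        rw [e2, ← e1]
        exact h3
      simpa [sub_mul] using h1.sub h2
  linarith [key k]

end Law

/-! ### The random walk on the graph -/

section Graph

variable {V : Type*} [Fintype V] [DecidableEq V] (G : SimpleGraph V) [DecidableRel G.Adj]

/-- The transition probabilities of the simple random walk. -/
def stepProb (w x : V) : ℝ≥0∞ := if G.Adj w x then (G.degree w : ℝ≥0∞)⁻¹ else 0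

variable {G}

omit [DecidableEq V] in
theorem degree_pos_of_ne (hG : G.Connected) {u v : V} (huv : u ≠ v) (x : V) : 0 < G.degree x := by
  have : Nontrivial V := ⟨u, v, huv⟩
  exact hG.preconnected.degree_pos_of_nontrivial x

/-- The walk is cut at its first vertex in `C`. -/
theorem exists_pathSum_ne_zero {r y : V} (w : G.Walk y r) {C : Finset V} (hr : r ∈ C) : ∃ j, pathSum (stepProb G) C C j y (fun _ => 1) ≠ 0 := by
  induction w with
  | nil => exact ⟨0, by simp [pathSum, hr]⟩
  | @cons a b c hab w ih =>
    by_cases ha : a ∈ C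
    · exact ⟨0, by simp [pathSum, ha]⟩
    · obtain ⟨j, hj⟩ := ih hr
      refine ⟨j + 1, ?_⟩
      simp only [pathSum, ha, if_false]
      intro h0
      rw [Finset.sum_eq_zero_iff] at h0
      have := h0 b (Finset.mem_univ b)
      simp [stepProb, hab] at this
      exact hj this

theorem isAbsorbing_stepProb (hG : G.Connected) {u v : V} (huv : u ≠ v) :
    IsAbsorbing (stepProb G) v := by
  have hdeg := fun x => (degree_pos_of_ne hG huv x).ne'
  have hsum : ∀ y, ∑ x, stepProb G y x = 1 := by
    intro y
    simp only [stepProb]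
    rw [← Finset.sum_filter, Finset.sum_const, ← SimpleGraph.neighborFinset_eq_filter,
      SimpleGraph.card_neighborFinset_eq_degree, nsmul_eq_mul]
    exact ENNReal.mul_inv_cancel (by exact_mod_cast hdeg y) (ENNReal.natCast_ne_top _)
  refine ⟨hsum, fun C hr y x => ?_⟩
  obtain ⟨w⟩ := hG.preconnected x v
  exact greenSum_singleton_ne_top (fun y => (hsum y).le) (exists_pathSum_ne_zero w hr) y

variable [MeasurableSpace V] [DiscreteMeasurableSpace V] {Ω : Type*} [MeasurableSpace Ω]
  {P : Measure Ω} [IsProbabilityMeasure P] {ι : Type*} {R : ι → V → ℕ → V → Ω → V}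

/-- The number of visits to `u` in run `i`. -/
def runVisits (R : ι → V → ℕ → V → Ω → V) (v : V) (order : List V) (u : V) (i : ι) (ω : Ω) : ℕ :=
  (wilson (fun a k w => R i a k w ω) v order).visits u

theorem measurable_runVisits (hR : ∀ i a k w, Measurable (R i a k w)) (v : V) (order : List V)
    (u : V) (i : ι) : Measurable (runVisits R v order u i) :=
  measurable_visits u order (fun b _ => hR i b) (initState v)

/-- The number of visits to `u` in a run of Wilson's algorithm is geometric. -/
theorem measureReal_runVisits (hG : G.Connected) {u v : V} (huv : u ≠ v) {order : List V}
    (hnodup : order.Nodup) (horder : ∀ x, x ∈ order ↔ x ≠ v) (hR : IsUniformNeighborTable G P R)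
    (i : ι) (k : ℕ) :
    P.real (runVisits R v order u i ⁻¹' {k}) = if k = 0 then 0 else
      (greenMatrix (stepProb G) {v} u u)⁻¹ *
        (1 - (greenMatrix (stepProb G) {v} u u)⁻¹) ^ (k - 1) := by
  have hp := isAbsorbing_stepProb hG huv
  refine measureReal_eq_of_lintegral_pow (measurable_runVisits hR.measurable v order u i)
    (one_le_greenMatrix (hp.greenSum_ne_top {v} (Finset.mem_singleton_self v)) u)
    (fun z hz0 hz1 => ?_) k
  have hz : ENNReal.ofReal z ≤ 1 := by simpa using ENNReal.ofReal_le_ofReal hz1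
  have hind : iIndepFun (fun j : V × ℕ × V => R i j.1 j.2.1 j.2.2) P :=
    hR.indep.precomp (g := fun j : V × ℕ × V => (i, j)) (Prod.mk_right_injective i)
  have h := lintegral_pow_visits hp hz u (hR.measurable i) (hR.uniform i) hind order hnodup
    (initState v) (by simp [initState]) (fun x => by
      by_cases hx : x = v
      · simp [initState, hx]
      · exact Or.inr ((horder x).2 hx))
  have h2 := visitGen_eq (u := u) (C := {v}) hp hz (Finset.mem_singleton_self v)
    (by simpa using huv)
  rw [ENNReal.toReal_ofReal hz0] at h2
  rw [← h2]
  simpa [initState, runVisits, wilson] using h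

/-- Run `i` is a function of the table entries with first index `i`, and these blocks are disjoint.
-/
theorem iIndepFun_runVisits (hR : IsUniformNeighborTable G P R) (v : V) (order : List V) (u : V) :
    iIndepFun (runVisits R v order u) P := by
  classical
  set X : ι × V × ℕ × V → Ω → V := fun j => R j.1 j.2.1 j.2.2.1 j.2.2.2 with hXdef
  have hX : ∀ j, Measurable (X j) := fun j => hR.measurable _ _ _ _
  have hmeas : ∀ (A : Set (ι × V × ℕ × V)) (i : ι), (∀ j, (i, j) ∈ A) →
      Measurable[generatedBy X A] (runVisits R v order u i) := by
    intro A i hi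
    exact @measurable_visits Ω (generatedBy X A) V _ _ _ _ (R i) u order
      (fun b _ k w => measurable_generatedBy (X := X) (A := A) (i := (i, b, k, w)) (hi _))
      (initState v)
  rw [iIndepFun_iff_measure_inter_preimage_eq_mul]
  intro S sets hsets
  induction S using Finset.induction_on with
  | empty => simp
  | insert a S ha ih =>
    rw [Finset.prod_insert ha, ← ih fun i hi => hsets i (Finset.mem_insert_of_mem hi),
      Finset.set_biInter_insert]
    have hdisj : Disjoint {j : ι × V × ℕ × V | j.1 = a} {j : ι × V × ℕ × V | j.1 ∈ S} := by
      rw [Set.disjoint_left]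
      rintro j hj hj'
      exact ha (by simpa [← show j.1 = a from hj] using hj')
    refine (Indep_iff _ _ _).1 (indep_generatedBy hX hR.indep hdisj) _ _ ?_ ?_
    · exact hmeas _ a (fun j => rfl) (hsets a (Finset.mem_insert_self a S))
    · refine @Finset.measurableSet_biInter _ _ (generatedBy X _) _ S fun i hi => ?_
      exact hmeas _ i (fun j => hi) (hsets i (Finset.mem_insert_of_mem hi))

end Graph

/-! ### The Green function and the normalized Laplacian -/

section Spectral

variable {V : Type*} [Fintype V] [DecidableEq V]

/-- An eigenvector of the matrix without `v`, extended by zero, is multiplied by `μ ^ n` under `n`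
killed steps. -/
theorem sum_pathSum_mul_eq_pow_mul {p : V → V → ℝ≥0∞} {v : V} (hp : IsAbsorbing p v) {μ : ℝ}
    {f : V → ℝ} (hv : f v = 0) (hf : ∀ x, x ≠ v → ∑ y, (p x y).toReal * f y = μ * f x) (n : ℕ)
    (x : V) : ∑ y, (pathSum p {v} {y} n x (fun _ => 1)).toReal * f y = μ ^ n * f x := by
  have hfin : ∀ n x y, pathSum p {v} {y} n x (fun _ => 1) ≠ ∞ := fun n x y =>
    ENNReal.ne_top_of_tsum_ne_top
      (hp.greenSum_ne_top {v} (Finset.mem_singleton_self v) x y) n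
  induction n generalizing x with
  | zero =>
    have : ∀ y, (pathSum p {v} {y} 0 x (fun _ => 1)).toReal * f y = if x = y then f y else 0 := by
      intro y
      by_cases h : x = y <;> simp [pathSum, h]
    simp [this]
  | succ n ih =>
    by_cases hx : x = v
    · simp [pathSum, hx, hv]
    · simp only [pathSum, Finset.mem_singleton, hx, if_false]
      have : ∀ y, (∑ k, p x k * pathSum p {v} {y} n k (fun _ => 1)).toReal * f y =
          ∑ k, (p x k).toReal * ((pathSum p {v} {y} n k (fun _ => 1)).toReal * f y) := by
        intro y
        rw [ENNReal.toReal_sum fun k _ => ENNReal.mul_ne_top (hp.ne_top x k) (hfin n k y),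
          Finset.sum_mul]
        exact Finset.sum_congr rfl fun k _ => by rw [ENNReal.toReal_mul, mul_assoc]
      simp_rw [this]
      rw [Finset.sum_comm]
      simp_rw [← Finset.mul_sum, ih]
      rw [pow_succ, mul_assoc, ← hf x hx, Finset.mul_sum]
      exact Finset.sum_congr rfl fun k _ => by ring

/-- The Green function is a convergent sum of the killed `n`-step weights, so these tend to zero,
and with them `μ ^ n * f x`. -/
theorem abs_lt_one_of_killed_eigenvector {p : V → V → ℝ≥0∞} {v : V} (hp : IsAbsorbing p v)
    {μ : ℝ} {f : V → ℝ} (hv : f v = 0)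
    (hf : ∀ x, x ≠ v → ∑ y, (p x y).toReal * f y = μ * f x) {x : V} (hx : f x ≠ 0) : |μ| < 1 := by
  by_contra hμ
  rw [not_lt] at hμ
  have hlim : Filter.Tendsto
      (fun n => ∑ y, (pathSum p {v} {y} n x (fun _ => 1)).toReal * f y) Filter.atTop
      (nhds (∑ y, (0 : ℝ) * f y)) := by
    refine tendsto_finsetSum _ fun y _ => Filter.Tendsto.mul_const _ ?_
    have := ENNReal.tendsto_atTop_zero_of_tsum_ne_top
      (hp.greenSum_ne_top {v} (Finset.mem_singleton_self v) x y)
    exact (ENNReal.tendsto_toReal ENNReal.zero_ne_top).comp this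
  simp_rw [sum_pathSum_mul_eq_pow_mul hp hv hf, zero_mul, Finset.sum_const_zero] at hlim
  have h2 := hlim.abs
  rw [abs_zero] at h2
  have h3 : |f x| ≤ 0 := ge_of_tendsto' h2 fun n => by
    rw [abs_mul, abs_pow]
    exact le_mul_of_one_le_left (abs_nonneg _) (one_le_pow₀ hμ)
  exact hx (abs_eq_zero.1 (le_antisymm h3 (abs_nonneg _)))

variable {G : SimpleGraph V} [DecidableRel G.Adj]

theorem transition_apply (x y : V) :
    transition G x y = if G.Adj x y then (G.degree x : ℝ)⁻¹ else 0 := by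
  rw [transition, Matrix.diagonal_mul, SimpleGraph.adjMatrix_apply]
  simp

theorem toReal_stepProb (x y : V) : (stepProb G x y).toReal = transition G x y := by
  rw [transition_apply, stepProb]
  split_ifs <;> simp

theorem normLaplacian_apply (hdeg : ∀ x, 0 < G.degree x) (x y : V) :
    normLaplacian G x y = (1 : Matrix V V ℝ) x y -
      √(G.degree x) * transition G x y * (√(G.degree y))⁻¹ := by
  have hx : (0 : ℝ) < G.degree x := by exact_mod_cast hdeg x
  have hs : √(G.degree x : ℝ) ≠ 0 := (Real.sqrt_pos.2 hx).ne'
  have hss : √(G.degree x : ℝ) * √(G.degree x : ℝ) = G.degree x := Real.mul_self_sqrt hx.le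
  rw [normLaplacian, Matrix.mul_diagonal, Matrix.diagonal_mul, SimpleGraph.lapMatrix,
    Matrix.sub_apply, transition_apply, SimpleGraph.adjMatrix_apply]
  have hinv : (G.degree x : ℝ)⁻¹ = (√(G.degree x : ℝ))⁻¹ * (√(G.degree x : ℝ))⁻¹ := by
    rw [← mul_inv, hss]
  by_cases hxy : x = y
  · subst hxy
    simp only [SimpleGraph.degMatrix, Matrix.diagonal_apply_eq, SimpleGraph.irrefl, if_false,
      Matrix.one_apply_eq, sub_zero, mul_zero, zero_mul]
    have : (√(G.degree x : ℝ))⁻¹ * G.degree x * (√(G.degree x : ℝ))⁻¹ = 1 := by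
      rw [mul_right_comm, ← hinv, inv_mul_cancel₀ hx.ne']
    exact this
  · simp only [SimpleGraph.degMatrix, Matrix.diagonal_apply_ne _ hxy, Matrix.one_apply_ne hxy]
    split_ifs
    · rw [hinv, ← mul_assoc, mul_inv_cancel₀ hs]
      ring
    · simp

variable {v : V}

/-- The conjugated Green function is a right inverse of the Laplacian without the root. -/
theorem deleteNode_normLaplacian_mul (hp : IsAbsorbing (stepProb G) v)
    (hdeg : ∀ x, 0 < G.degree x) :
    deleteNode (normLaplacian G) v * (Matrix.of fun x y : {x : V // x ≠ v} =>
      √(G.degree x.1) * greenMatrix (stepProb G) {v} x.1 y.1 * (√(G.degree y.1))⁻¹) = 1 := by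
  have hs : ∀ x, √(G.degree x : ℝ) ≠ 0 := fun x =>
    (Real.sqrt_pos.2 (by exact_mod_cast hdeg x)).ne'
  have hK := killedMatrix_mul_greenMatrix hp.ne_top
    (hp.greenSum_ne_top {v} (Finset.mem_singleton_self v))
  ext x y
  have h1 := congrFun (congrFun hK x.1) y.1
  rw [Matrix.mul_apply, ← Fintype.sum_subtype_add_sum_subtype (fun k => k ≠ v)] at h1
  -- The walk is killed at `v`, so the Green function from `v` to `y ≠ v` vanishes and the column of
  -- `v` can be dropped.
  have h2 : ∀ k : {k // ¬ k ≠ v}, killedMatrix (stepProb G) {v} x.1 k.1 *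
      greenMatrix (stepProb G) {v} k.1 y.1 = 0 := by
    rintro ⟨k, hk⟩
    have hk' : k = v := not_not.1 hk
    have : greenMatrix (stepProb G) {v} k y.1 = 0 := by
      rw [greenMatrix, greenSum_eq]
      simp [hk', y.2.symm]
    simp [this]
  rw [Finset.sum_eq_zero (fun k _ => h2 k), add_zero] at h1
  rw [Matrix.mul_apply]
  have h3 : ∀ k : {k // k ≠ v}, deleteNode (normLaplacian G) v x k *
      Matrix.of (fun x y : {x : V // x ≠ v} =>
        √(G.degree x.1) * greenMatrix (stepProb G) {v} x.1 y.1 * (√(G.degree y.1))⁻¹) k y =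
      √(G.degree x.1) * (killedMatrix (stepProb G) {v} x.1 k.1 *
        greenMatrix (stepProb G) {v} k.1 y.1) * (√(G.degree y.1))⁻¹ := by
    intro k
    have hkx : deleteNode (normLaplacian G) v x k =
        √(G.degree x.1) * killedMatrix (stepProb G) {v} x.1 k.1 * (√(G.degree k.1))⁻¹ := by
      rw [deleteNode, Matrix.submatrix_apply, normLaplacian_apply hdeg, killedMatrix,
        toReal_stepProb]
      simp only [Finset.mem_singleton, x.2, if_false]
      by_cases h : x.1 = k.1
      · rw [h, Matrix.one_apply_eq]
        have := hs k.1
        field_simp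
      · rw [Matrix.one_apply_ne h]
        ring
    rw [hkx, Matrix.of_apply]
    have := hs k.1
    field_simp
  rw [Finset.sum_congr rfl fun k _ => h3 k, ← Finset.sum_mul, ← Finset.mul_sum, h1]
  by_cases h : x = y
  · subst h
    simp [hs]
  · have : x.1 ≠ y.1 := fun h' => h (Subtype.ext h')
    simp [h, this]

theorem inv_deleteNode_normLaplacian_apply (hp : IsAbsorbing (stepProb G) v)
    (hdeg : ∀ x, 0 < G.degree x) (u : {x : V // x ≠ v}) :
    (deleteNode (normLaplacian G) v)⁻¹ u u = greenMatrix (stepProb G) {v} u.1 u.1 := by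
  have hs : √(G.degree u.1 : ℝ) ≠ 0 := (Real.sqrt_pos.2 (by exact_mod_cast hdeg u.1)).ne'
  rw [Matrix.inv_eq_right_inv (deleteNode_normLaplacian_mul hp hdeg), Matrix.of_apply]
  field_simp

theorem abs_lt_one_of_mem_spectrum (hp : IsAbsorbing (stepProb G) v) {μ : ℝ}
    (hμ : μ ∈ spectrum ℝ (deleteNode (transition G) v)) : |μ| < 1 := by
  rw [← Matrix.spectrum_toLin', ← Module.End.hasEigenvalue_iff_mem_spectrum] at hμ
  obtain ⟨f, hf⟩ := hμ.exists_hasEigenvector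
  obtain ⟨x, hx⟩ := Function.ne_iff.1 hf.2
  have heq := hf.apply_eq_smul
  set F : V → ℝ := fun y => if h : y ≠ v then f ⟨y, h⟩ else 0 with hF
  refine abs_lt_one_of_killed_eigenvector hp (f := F) (μ := μ) (by simp [hF]) (fun y hy => ?_)
    (x := x.1) (by simpa [hF, x.2] using hx)
  have h1 := congrFun heq ⟨y, hy⟩
  rw [Matrix.toLin'_apply] at h1
  simp only [Matrix.mulVec, dotProduct, Pi.smul_apply, smul_eq_mul] at h1
  rw [← Fintype.sum_subtype_add_sum_subtype (fun k => k ≠ v)]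
  have h2 : ∀ k : {k // ¬ k ≠ v}, (stepProb G y k.1).toReal * F k.1 = 0 := by
    rintro ⟨k, hk⟩
    have hk' : k = v := not_not.1 hk
    simp [hF, hk']
  rw [Finset.sum_eq_zero (fun k _ => h2 k), add_zero]
  have h3 : F y = f ⟨y, hy⟩ := by simp [hF, hy]
  rw [h3, ← h1]
  refine Finset.sum_congr rfl fun k _ => ?_
  have h4 : F k.1 = f k := by simp [hF, k.2]
  rw [h4, toReal_stepProb, deleteNode, Matrix.submatrix_apply]

/-- Conjugation by `D^{1/2}` makes the killed transition matrix symmetric, which opens the way to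
the spectral theorem. -/
theorem spectrum_one_sub_normLaplacian (hdeg : ∀ x, 0 < G.degree x) :
    spectrum ℝ (1 - deleteNode (normLaplacian G) v) =
      spectrum ℝ (deleteNode (transition G) v) := by
  have hs : ∀ x, √(G.degree x : ℝ) ≠ 0 := fun x =>
    (Real.sqrt_pos.2 (by exact_mod_cast hdeg x)).ne'
  set d : {x : V // x ≠ v} → ℝ := fun x => √(G.degree x.1) with hd
  have hd1 : Matrix.diagonal d * Matrix.diagonal (fun x => (d x)⁻¹) = 1 := by
    rw [Matrix.diagonal_mul_diagonal, ← Matrix.diagonal_one]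
    congr 1
    ext x
    exact mul_inv_cancel₀ (hs x.1)
  let U : (Matrix {x : V // x ≠ v} {x : V // x ≠ v} ℝ)ˣ :=
    ⟨Matrix.diagonal d, Matrix.diagonal (fun x => (d x)⁻¹), hd1, mul_eq_one_comm.1 hd1⟩
  have : 1 - deleteNode (normLaplacian G) v =
      (U : Matrix _ _ ℝ) * deleteNode (transition G) v * ((U⁻¹ : (Matrix {x : V // x ≠ v} {x : V // x ≠ v} ℝ)ˣ) :
        Matrix {x : V // x ≠ v} {x : V // x ≠ v} ℝ) := by
    ext x y
    change _ = (Matrix.diagonal d * deleteNode (transition G) v *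
      Matrix.diagonal (fun x => (d x)⁻¹)) x y
    rw [Matrix.mul_diagonal, Matrix.diagonal_mul, Matrix.sub_apply, deleteNode,
      Matrix.submatrix_apply, normLaplacian_apply hdeg, deleteNode, Matrix.submatrix_apply]
    by_cases h : x = y
    · subst h; simp [hd]
    · have : x.1 ≠ y.1 := fun h' => h (Subtype.ext h')
      simp [h, this, hd]
  rw [this, spectrum.units_conjugate]

theorem isHermitian_one_sub_normLaplacian :
    (1 - deleteNode (normLaplacian G) v).IsHermitian := by
  refine Matrix.isHermitian_one.sub (Matrix.IsHermitian.submatrix ?_ _)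
  rw [Matrix.IsHermitian, normLaplacian, Matrix.conjTranspose_mul, Matrix.conjTranspose_mul,
    Matrix.diagonal_conjTranspose, Matrix.conjTranspose_eq_transpose_of_trivial (G.lapMatrix ℝ),
    (G.isSymm_lapMatrix ℝ).eq, star_trivial, mul_assoc]

/-- The spectral bounds on the Green function. -/
theorem greenMatrix_spectral_bound (hp : IsAbsorbing (stepProb G) v)
    (hdeg : ∀ x, 0 < G.degree x) (u : {x : V // x ≠ v}) :
    0 ≤ trapEigenvalue G v ∧ trapEigenvalue G v < 1 ∧
      greenMatrix (stepProb G) {v} u.1 u.1 * (1 - trapEigenvalue G v) ≤ 1 := by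
  set N := 1 - deleteNode (normLaplacian G) v with hN
  have hherm : N.IsHermitian := isHermitian_one_sub_normLaplacian
  have hspec : spectrum ℝ N = spectrum ℝ (deleteNode (transition G) v) :=
    spectrum_one_sub_normLaplacian hdeg
  have hfin : ((fun x : ℝ => |x|) '' spectrum ℝ (deleteNode (transition G) v)).Finite :=
    (Matrix.finite_spectrum _).image _
  have hne : ((fun x : ℝ => |x|) '' spectrum ℝ (deleteNode (transition G) v)).Nonempty :=
    ⟨_, hherm.eigenvalues u, hspec ▸ hherm.eigenvalues_mem_spectrum_real u, rfl⟩
  have hle : ∀ μ ∈ spectrum ℝ N, |μ| ≤ trapEigenvalue G v := fun μ hμ =>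
    le_csSup hfin.bddAbove ⟨μ, hspec ▸ hμ, rfl⟩
  have h0 : 0 ≤ trapEigenvalue G v :=
    (abs_nonneg _).trans (hle _ (hherm.eigenvalues_mem_spectrum_real u))
  have h1 : trapEigenvalue G v < 1 := by
    rw [trapEigenvalue, hfin.csSup_lt_iff hne]
    rintro _ ⟨μ, hμ, rfl⟩
    exact abs_lt_one_of_mem_spectrum hp hμ
  refine ⟨h0, h1, ?_⟩
  have hps : (algebraMap ℝ (Matrix {x : V // x ≠ v} {x : V // x ≠ v} ℝ) (trapEigenvalue G v) -
      N).PosSemidef := by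
    rw [Matrix.posSemidef_iff_isHermitian_and_spectrum_nonneg]
    refine ⟨?_, ?_⟩
    · refine Matrix.IsHermitian.sub ?_ hherm
      rw [Algebra.algebraMap_eq_smul_one]
      simp [Matrix.IsHermitian]
    · rw [← spectrum.singleton_sub_eq]
      rintro _ ⟨a, ha, μ, hμ, rfl⟩
      rw [Set.mem_singleton_iff.1 ha]
      exact sub_nonneg.2 ((le_abs_self _).trans (hle μ hμ))
  set X : Matrix {x : V // x ≠ v} {x : V // x ≠ v} ℝ := Matrix.of fun x y =>
      √(G.degree x.1) * greenMatrix (stepProb G) {v} x.1 y.1 * (√(G.degree y.1))⁻¹ with hX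
  set x : {x : V // x ≠ v} → ℝ := fun k => X k u with hx
  have hs : √(G.degree u.1 : ℝ) ≠ 0 := (Real.sqrt_pos.2 (by exact_mod_cast hdeg u.1)).ne'
  have hxu : x u = greenMatrix (stepProb G) {v} u.1 u.1 := by
    simp only [hx, hX, Matrix.of_apply]
    field_simp
  have hg1 : 1 ≤ greenMatrix (stepProb G) {v} u.1 u.1 :=
    one_le_greenMatrix (hp.greenSum_ne_top {v} (Finset.mem_singleton_self v)) u.1
  have hLx : (deleteNode (normLaplacian G) v).mulVec x = Pi.single u 1 := by
    ext k
    have := congrFun (congrFun (deleteNode_normLaplacian_mul hp hdeg) k) u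
    rw [Matrix.mul_apply] at this
    rw [Matrix.mulVec, dotProduct]
    refine this.trans ?_
    simp [Matrix.one_apply, Pi.single_apply]
  -- For the column `x` of the inverse, `N x = x - e_u` and `x u = g`, so nonnegativity says (1 -
  -- λ)|x|² ≤ g; combined with |x|² ≥ g² this gives the claim.
  have hq := hps.dotProduct_mulVec_nonneg x
  have hNx : N.mulVec x = x - Pi.single u 1 := by
    rw [hN, Matrix.sub_mulVec, Matrix.one_mulVec, hLx]
  rw [Matrix.sub_mulVec, hNx, Algebra.algebraMap_eq_smul_one, Matrix.smul_mulVec,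
    Matrix.one_mulVec, star_trivial, dotProduct_sub, dotProduct_sub, dotProduct_smul,
    dotProduct_single, smul_eq_mul, mul_one, hxu] at hq
  have hsq : x u * x u ≤ x ⬝ᵥ x :=
    Finset.single_le_sum (f := fun i => x i * x i) (fun i _ => mul_self_nonneg _)
      (Finset.mem_univ u)
  rw [hxu] at hsq
  set g := greenMatrix (stepProb G) {v} u.1 u.1
  set lam := trapEigenvalue G v
  have h2 : (1 - lam) * (g * g) ≤ (1 - lam) * (x ⬝ᵥ x) :=
    mul_le_mul_of_nonneg_left hsq (by linarith)
  have h3 : g * (g * (1 - lam)) ≤ g * 1 := by nlinarith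
  exact le_of_mul_le_mul_left h3 (by linarith)

end Spectral

/-! ### Analytic estimates for geometric variables -/

/-- This is b/2 ≤ sinh(b/2), squared. It bounds the geometric variance by that of an exponential
variable and gives the convexity below. -/
theorem sq_mul_exp_neg_le {b : ℝ} (hb : 0 < b) :
    b ^ 2 * Real.exp (-b) ≤ (1 - Real.exp (-b)) ^ 2 := by
  have h1 : b / 2 ≤ Real.sinh (b / 2) := Real.self_le_sinh_iff.2 (by linarith)
  rw [Real.sinh_eq] at h1
  have h2 : b * Real.exp (-(b / 2)) ≤ 1 - Real.exp (-b) := by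
    have h3 : b * Real.exp (-(b / 2)) ≤
        (Real.exp (b / 2) - Real.exp (-(b / 2))) * Real.exp (-(b / 2)) :=
      mul_le_mul_of_nonneg_right (by linarith) (Real.exp_pos _).le
    rw [sub_mul, ← Real.exp_add, ← Real.exp_add] at h3
    ring_nf at h3 ⊢
    simpa using h3
  have h4 : b ^ 2 * Real.exp (-b) = (b * Real.exp (-(b / 2))) ^ 2 := by
    rw [mul_pow, ← Real.exp_nat_mul]
    congr 2
    push_cast
    ring
  rw [h4]
  exact pow_le_pow_left₀ (by positivity) h2 2

theorem one_sub_exp_neg_pos {y : ℝ} (hy : 0 < y) : 0 < 1 - Real.exp (-y) := by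
  have : Real.exp (-y) < 1 := Real.exp_lt_one_iff.2 (by linarith)
  linarith

theorem hasDerivAt_log_one_sub_exp_neg_sub_log {y : ℝ} (hy : 0 < y) :
    HasDerivAt (fun y => Real.log (1 - Real.exp (-y)) - Real.log y)
      ((1 - Real.exp (-y))⁻¹ - 1 - y⁻¹) y := by
  have h1 := one_sub_exp_neg_pos hy
  have h2 : HasDerivAt (fun y : ℝ => 1 - Real.exp (-y)) (Real.exp (-y)) y := by
    simpa using ((hasDerivAt_neg y).exp).const_sub 1
  have h3 := (h2.log h1.ne').sub (Real.hasDerivAt_log hy.ne')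
  refine h3.congr_deriv ?_
  field_simp
  ring

/-- The logarithm of the Laplace transform of the uniform distribution is convex. -/
theorem convexOn_log_one_sub_exp_neg_sub_log :
    ConvexOn ℝ (Set.Ioi 0) fun y => Real.log (1 - Real.exp (-y)) - Real.log y := by
  have hderiv : ∀ y ∈ Set.Ioi (0 : ℝ),
      deriv (fun y => Real.log (1 - Real.exp (-y)) - Real.log y) y =
        (1 - Real.exp (-y))⁻¹ - 1 - y⁻¹ := fun y hy =>
    (hasDerivAt_log_one_sub_exp_neg_sub_log hy).deriv
  have hderiv2 : ∀ y ∈ Set.Ioi (0 : ℝ), HasDerivAt (fun y => (1 - Real.exp (-y))⁻¹ - 1 - y⁻¹)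
      (-Real.exp (-y) / (1 - Real.exp (-y)) ^ 2 + (y ^ 2)⁻¹) y := by
    intro y hy
    have h2 : HasDerivAt (fun y : ℝ => 1 - Real.exp (-y)) (Real.exp (-y)) y := by
      simpa using ((hasDerivAt_neg y).exp).const_sub 1
    have h3 := ((h2.inv (one_sub_exp_neg_pos hy).ne').sub_const 1).sub
      (hasDerivAt_inv (ne_of_gt hy))
    refine h3.congr_deriv ?_
    ring
  refine MonotoneOn.convexOn_of_deriv (convex_Ioi 0)
    (fun y hy => (hasDerivAt_log_one_sub_exp_neg_sub_log hy).continuousAt.continuousWithinAt)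
    ?_ ?_
  · rw [interior_Ioi]
    exact fun y hy =>
      (hasDerivAt_log_one_sub_exp_neg_sub_log hy).differentiableAt.differentiableWithinAt
  · rw [interior_Ioi]
    have hm : MonotoneOn (fun y : ℝ => (1 - Real.exp (-y))⁻¹ - 1 - y⁻¹) (Set.Ioi 0) := by
      refine monotoneOn_of_deriv_nonneg (convex_Ioi 0)
        (fun y hy => (hderiv2 y hy).continuousAt.continuousWithinAt) ?_ ?_
      · rw [interior_Ioi]
        exact fun y hy => (hderiv2 y hy).differentiableAt.differentiableWithinAt
      · rw [interior_Ioi]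
        intro y hy
        rw [(hderiv2 y hy).deriv]
        have hy0 : (0 : ℝ) < y := hy
        have h1 := one_sub_exp_neg_pos hy0
        have h2 := sq_mul_exp_neg_le hy0
        have h3 : Real.exp (-y) / (1 - Real.exp (-y)) ^ 2 ≤ (y ^ 2)⁻¹ := by
          rw [div_le_iff₀ (by positivity), ← div_eq_inv_mul, le_div_iff₀ (by positivity)]
          linarith
        rw [neg_div]
        linarith
    exact hm.congr fun y hy => (hderiv y hy).symm

/-- The tangent line inequality for the function above. -/
theorem log_one_sub_exp_neg_tangent {a b : ℝ} (ha : 0 < a) (hb : 0 < b) :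
    (Real.log (1 - Real.exp (-b)) - Real.log b) + ((1 - Real.exp (-b))⁻¹ - 1 - b⁻¹) * (a - b) ≤
      Real.log (1 - Real.exp (-a)) - Real.log a := by
  have hc := convexOn_log_one_sub_exp_neg_sub_log
  have hd := hasDerivAt_log_one_sub_exp_neg_sub_log hb
  rcases lt_trichotomy a b with h | rfl | h
  · have h1 := hc.slope_le_of_hasDerivAt (x := a) (y := b) ha hb h hd
    rw [slope_def_field, div_le_iff₀ (by linarith)] at h1
    nlinarith
  · simp
  · have h1 := hc.le_slope_of_hasDerivAt (x := b) (y := a) hb ha h hd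
    rw [slope_def_field, le_div_iff₀ (by linarith)] at h1
    nlinarith

/-- The centred moment generating function of a geometric variable is dominated by that of an
exponential variable. -/
theorem geometric_mgf_le {b x : ℝ} (hb : 0 < b) (hx : x < 1) :
    (1 - Real.exp (-b)) * Real.exp (x * b) / (1 - Real.exp (-b) * Real.exp (x * b)) ≤
      Real.exp (x * b * (1 - Real.exp (-b))⁻¹ + (-x - Real.log (1 - x))) := by
  have ha : 0 < b * (1 - x) := mul_pos hb (by linarith)
  -- The claim is, up to rearrangement, the tangent at `b` evaluated at `b * (1 - x)`.
  have h1 := log_one_sub_exp_neg_tangent ha hb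
  have hpa := one_sub_exp_neg_pos ha
  have hpb := one_sub_exp_neg_pos hb
  have he : Real.exp (-b) * Real.exp (x * b) = Real.exp (-(b * (1 - x))) := by
    rw [← Real.exp_add]; congr 1; ring
  rw [he, ← Real.log_le_iff_le_exp (by positivity), Real.log_div (by positivity) hpa.ne',
    Real.log_mul hpb.ne' (Real.exp_pos _).ne', Real.log_exp]
  rw [Real.log_mul hb.ne' (by linarith)] at h1
  have h2 : ((1 - Real.exp (-b))⁻¹ - 1 - b⁻¹) * (b * (1 - x) - b) =
      -(x * b * (1 - Real.exp (-b))⁻¹) + x * b + x := by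
    field_simp
    ring
  rw [h2] at h1
  linarith

/-- Termwise in the power series, which starts at degree two: there t^k ≤ t². -/
theorem neg_log_one_sub_sub_le {x t : ℝ} (hx0 : 0 ≤ x) (hx1 : x < 1) (ht0 : 0 ≤ t) (ht1 : t ≤ 1) :
    -(t * x) - Real.log (1 - t * x) ≤ t ^ 2 * (-x - Real.log (1 - x)) := by
  have key : ∀ y : ℝ, 0 ≤ y → y < 1 →
      HasSum (fun n : ℕ => y ^ (n + 2) / ((n : ℝ) + 2)) (-y - Real.log (1 - y)) := by
    intro y hy0 hy1
    have h := Real.hasSum_pow_div_log_of_abs_lt_one (x := y) (by rwa [abs_of_nonneg hy0])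
    have h2 := (hasSum_nat_add_iff' 1).2 h
    have e1 : -Real.log (1 - y) - ∑ i ∈ Finset.range 1, y ^ (i + 1) / ((i : ℝ) + 1) =
        -y - Real.log (1 - y) := by
      simp; ring
    have e2 : (fun n : ℕ => y ^ (n + 1 + 1) / (((n + 1 : ℕ) : ℝ) + 1)) =
        fun n : ℕ => y ^ (n + 2) / ((n : ℝ) + 2) := by
      ext n
      push_cast
      rw [add_assoc, add_assoc]
      norm_num
    rw [e1, e2] at h2
    exact h2
  have htx : t * x ≤ x := mul_le_of_le_one_left hx0 ht1
  refine hasSum_le (fun n => ?_) (key (t * x) (by positivity) (by linarith))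
    ((key x hx0 hx1).mul_left (t ^ 2))
  rw [mul_pow, mul_div_assoc, pow_add]
  refine mul_le_mul_of_nonneg_right ?_ (by positivity)
  exact mul_le_of_le_one_left (by positivity) (pow_le_one₀ ht0 ht1)

theorem sub_log_one_add_le {x : ℝ} (hx : 0 ≤ x) : x - Real.log (1 + x) ≤ x ^ 2 / 2 := by
  have h1 := Real.le_log_one_add_of_nonneg hx
  have h2 : x - x ^ 2 / 2 ≤ 2 * x / (x + 2) := by
    rw [le_div_iff₀ (by linarith)]
    nlinarith [pow_nonneg hx 3]
  linarith

/-! ### Concentration of averages of geometric variables -/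

section Concentration

variable {Ω : Type*} [MeasurableSpace Ω] {P : Measure Ω} [IsProbabilityMeasure P] {b : ℝ}

/-- `X` is geometric on the positive integers with failure probability `exp (-b)`. -/
structure IsGeometric (X : Ω → ℕ) (P : Measure Ω) (b : ℝ) : Prop where
  measurable : Measurable X
  real_preimage : ∀ k, P.real (X ⁻¹' {k}) =
    if k = 0 then 0 else (1 - Real.exp (-b)) * Real.exp (-b) ^ (k - 1)

variable {X : Ω → ℕ}

/-- `geometricMeasure` counts failures from `0`, hence the shift by one. -/
theorem IsGeometric.hasSum_integral (hX : IsGeometric X P b) (hb : 0 < b) {f : ℕ → ℝ} {c : ℝ}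
    (hf : ∀ k, 0 ≤ f k)
    (h : HasSum (fun n => Real.exp (-b) ^ n * f (n + 1)) c) :
    Integrable (fun ω => f (X ω)) P ∧ ∫ ω, f (X ω) ∂P = (1 - Real.exp (-b)) * c := by
  have hp := one_sub_exp_neg_pos hb
  let p : unitInterval := ⟨1 - Real.exp (-b), hp.le, by linarith [Real.exp_pos (-b)]⟩
  have hp0 : p ≠ 0 := fun h => hp.ne' (congrArg Subtype.val h)
  have hpv : (1 - (p : ℝ)) = Real.exp (-b) := by simp [p]
  have hlaw : P.map X = (geometricMeasure p).map (fun n => n + 1) := by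
    refine Measure.ext_of_singleton fun k => ?_
    rw [Measure.map_apply hX.measurable (measurableSet_singleton k),
      Measure.map_apply Measurable.of_discrete (measurableSet_singleton k)]
    rw [← ENNReal.toReal_eq_toReal_iff' (measure_ne_top _ _) (measure_ne_top _ _)]
    change P.real _ = (geometricMeasure p).real _
    rw [hX.real_preimage]
    cases k with
    | zero =>
      have : (fun n : ℕ => n + 1) ⁻¹' {0} = ∅ := by ext n; simp
      rw [this]; simp
    | succ k =>
      have : (fun n : ℕ => n + 1) ⁻¹' {k + 1} = {k} := by ext n; simp
      rw [this, geometricMeasure_real_singleton hp0, hpv]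
      simp only [Nat.add_eq_zero_iff, one_ne_zero, and_false, if_false, Nat.add_sub_cancel]
      rw [mul_comm]
  have hsum : HasSum (fun n => (1 - (p : ℝ)) ^ n * p * f (n + 1)) ((1 - Real.exp (-b)) * c) := by
    have e : (fun n => (1 - (p : ℝ)) ^ n * p * f (n + 1)) =
        fun n => (1 - Real.exp (-b)) * (Real.exp (-b) ^ n * f (n + 1)) := by
      ext n
      rw [hpv]
      simp only [p]
      ring
    rw [e]
    exact h.mul_left _
  have hint : Integrable (fun n => f (n + 1)) (geometricMeasure p) := by
    rw [integrable_geometricMeasure_iff hp0]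
    refine hsum.summable.congr fun n => ?_
    rw [Real.norm_of_nonneg (hf _)]
  have hmapint : Integrable f (P.map X) := by
    rw [hlaw, integrable_map_measure (by fun_prop) (by fun_prop)]
    exact hint
  refine ⟨hmapint.comp_measurable hX.measurable, ?_⟩
  rw [← integral_map (f := f) hX.measurable.aemeasurable (by fun_prop), hlaw,
    integral_map (by fun_prop) (by fun_prop), integral_geometricMeasure' hp0 hint]
  simpa using hsum.tsum_eq

theorem IsGeometric.integral_eq (hX : IsGeometric X P b) (hb : 0 < b) :
    ∫ ω, (X ω : ℝ) ∂P = (1 - Real.exp (-b))⁻¹ := by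
  have hp := one_sub_exp_neg_pos hb
  have hn : ‖Real.exp (-b)‖ < 1 := by
    rw [Real.norm_of_nonneg (Real.exp_pos _).le]; linarith
  have h := hasSum_choose_mul_geometric_of_norm_lt_one 1 hn
  have e : (fun n : ℕ => (((n + 1).choose 1 : ℕ) : ℝ) * Real.exp (-b) ^ n) =
      fun n => Real.exp (-b) ^ n * ((n + 1 : ℕ) : ℝ) := by
    ext n
    rw [Nat.choose_one_right, mul_comm]
  rw [e] at h
  rw [(hX.hasSum_integral hb (f := fun k => (k : ℝ)) (fun k => Nat.cast_nonneg k) h).2]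
  field_simp

theorem IsGeometric.sq (hX : IsGeometric X P b) (hb : 0 < b) :
    Integrable (fun ω => (X ω : ℝ) ^ 2) P ∧ ∫ ω, (X ω : ℝ) ^ 2 ∂P =
      2 * ((1 - Real.exp (-b))⁻¹) ^ 2 - (1 - Real.exp (-b))⁻¹ := by
  have hp := one_sub_exp_neg_pos hb
  have hn : ‖Real.exp (-b)‖ < 1 := by
    rw [Real.norm_of_nonneg (Real.exp_pos _).le]; linarith
  have h1 := hasSum_choose_mul_geometric_of_norm_lt_one 1 hn
  have h2 := hasSum_choose_mul_geometric_of_norm_lt_one 2 hn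
  have h := (h2.mul_left 2).sub h1
  -- With k = n + 1, k² = 2·C(k + 1, 2) - k, and both binomial series are known.
  have e : (fun n : ℕ => 2 * ((((n + 2).choose 2 : ℕ) : ℝ) * Real.exp (-b) ^ n) -
      (((n + 1).choose 1 : ℕ) : ℝ) * Real.exp (-b) ^ n) =
      fun n => Real.exp (-b) ^ n * ((n + 1 : ℕ) : ℝ) ^ 2 := by
    ext n
    rw [Nat.choose_one_right, Nat.cast_choose_two]
    push_cast
    ring
  rw [e] at h
  obtain ⟨i1, i2⟩ := hX.hasSum_integral hb (f := fun k => (k : ℝ) ^ 2) (fun k => by positivity) h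
  refine ⟨i1, ?_⟩
  rw [i2]
  field_simp
  ring

theorem IsGeometric.memLp (hX : IsGeometric X P b) (hb : 0 < b) :
    MemLp (fun ω => (X ω : ℝ)) 2 P := by
  have hm : Measurable fun ω => (X ω : ℝ) := measurable_from_nat.comp hX.measurable
  exact (memLp_two_iff_integrable_sq hm.aestronglyMeasurable).2 (hX.sq hb).1

theorem IsGeometric.variance_le (hX : IsGeometric X P b) (hb : 0 < b) :
    variance (fun ω => (X ω : ℝ)) P ≤ (b ^ 2)⁻¹ := by
  have hp := one_sub_exp_neg_pos hb
  rw [variance_eq_sub (hX.memLp hb)]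
  simp only [Pi.pow_apply]
  rw [(hX.sq hb).2, hX.integral_eq hb]
  have h1 : 2 * ((1 - Real.exp (-b))⁻¹) ^ 2 - (1 - Real.exp (-b))⁻¹ - ((1 - Real.exp (-b))⁻¹) ^ 2 =
      Real.exp (-b) / (1 - Real.exp (-b)) ^ 2 := by
    field_simp
    ring
  rw [h1, div_le_iff₀ (by positivity), ← div_eq_inv_mul, le_div_iff₀ (by positivity), mul_comm]
  exact sq_mul_exp_neg_le hb

theorem IsGeometric.mgf_le (hX : IsGeometric X P b) (hb : 0 < b) {x : ℝ} (hx : x < 1) :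
    Integrable (fun ω => Real.exp (x * b * (X ω : ℝ))) P ∧
      mgf (fun ω => (X ω : ℝ)) P (x * b) ≤
        Real.exp (x * b * (1 - Real.exp (-b))⁻¹ + (-x - Real.log (1 - x))) := by
  have hr : Real.exp (-b) * Real.exp (x * b) < 1 := by
    rw [← Real.exp_add, Real.exp_lt_one_iff]
    nlinarith
  have h := (hasSum_geometric_of_lt_one (by positivity) hr).mul_left (Real.exp (x * b))
  have e : (fun n : ℕ => Real.exp (x * b) * (Real.exp (-b) * Real.exp (x * b)) ^ n) =
      fun n => Real.exp (-b) ^ n * Real.exp (x * b * ((n + 1 : ℕ) : ℝ)) := by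
    ext n
    rw [mul_comm (x * b) ((n + 1 : ℕ) : ℝ), Real.exp_nat_mul, mul_pow, pow_succ]
    ring
  rw [e] at h
  obtain ⟨i1, i2⟩ := hX.hasSum_integral hb (f := fun k => Real.exp (x * b * (k : ℝ)))
    (fun k => (Real.exp_pos _).le) h
  refine ⟨i1, ?_⟩
  rw [mgf, i2, ← mul_assoc, ← div_eq_mul_inv]
  exact geometric_mgf_le hb hx

variable {l : ℕ} {Y : Fin l → Ω → ℕ}

theorem mgf_sum_geometric_le (hY : ∀ i, IsGeometric (Y i) P b) (hb : 0 < b) (hind : iIndepFun Y P)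
    {x : ℝ} (hx : x < 1) :
    Integrable (fun ω => Real.exp (x * b * ∑ i, (Y i ω : ℝ))) P ∧
      mgf (fun ω => ∑ i, (Y i ω : ℝ)) P (x * b) ≤
        Real.exp (l * (x * b * (1 - Real.exp (-b))⁻¹ + (-x - Real.log (1 - x)))) := by
  set Z : Fin l → Ω → ℝ := fun i ω => (Y i ω : ℝ) with hZ
  have hZm : ∀ i, Measurable (Z i) := fun i => measurable_from_nat.comp (hY i).measurable
  have hZi : iIndepFun Z P := hind.comp (fun _ k => (k : ℝ)) fun _ => measurable_from_nat
  have hs : (fun ω => ∑ i, (Y i ω : ℝ)) = ∑ i, Z i := by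
    ext ω; simp [hZ]
  refine ⟨?_, ?_⟩
  · have := hZi.integrable_exp_mul_sum hZm (s := Finset.univ) (t := x * b)
      fun i _ => ((hY i).mgf_le hb hx).1
    simpa [hZ] using this
  · rw [hs, hZi.mgf_sum hZm, Real.exp_nat_mul]
    refine (Finset.prod_le_prod (fun i _ => mgf_nonneg)
      fun i _ => ((hY i).mgf_le hb hx).2).trans ?_
    simp

/-- The average has variance at most 1/(l b²). -/
theorem chebyshev_geometric (hY : ∀ i, IsGeometric (Y i) P b) (hb : 0 < b)
    (hind : iIndepFun Y P) (hl : 0 < l) {s c : ℝ} (hs : 0 < s) (hc : 0 < c)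
    (hcs : c ^ 2 ≤ l * (s ^ 2 * b ^ 2)) :
    P.real {ω | s ≤ |(1 - Real.exp (-b))⁻¹ - (∑ i, (Y i ω : ℝ)) / l|} ≤ (c ^ 2)⁻¹ := by
  have hl' : (0 : ℝ) < l := by exact_mod_cast hl
  set Z : Fin l → Ω → ℝ := fun i ω => (Y i ω : ℝ) with hZ
  have hZi : iIndepFun Z P := hind.comp (fun _ k => (k : ℝ)) fun _ => measurable_from_nat
  have hmem : ∀ i, MemLp (Z i) 2 P := fun i => (hY i).memLp hb
  have hvar : variance (∑ i, Z i) P ≤ l * (b ^ 2)⁻¹ := by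
    rw [IndepFun.variance_sum (fun i _ => hmem i) fun i _ j _ hij => hZi.indepFun hij]
    refine (Finset.sum_le_sum fun i _ => (hY i).variance_le hb).trans ?_
    simp
  have hmean : ∫ ω, (∑ i, Z i) ω ∂P = l * (1 - Real.exp (-b))⁻¹ := by
    simp only [Finset.sum_apply]
    rw [integral_finsetSum _ fun i _ => (hmem i).integrable (by norm_num)]
    rw [Finset.sum_congr rfl fun i _ => (hY i).integral_eq hb]
    simp
  have h1 := meas_ge_le_variance_div_sq (memLp_finsetSum' Finset.univ fun i _ => hmem i)
    (mul_pos hl' hs)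
  rw [hmean] at h1
  have hset : {ω | s ≤ |(1 - Real.exp (-b))⁻¹ - (∑ i, (Y i ω : ℝ)) / l|} ⊆
      {ω | l * s ≤ |(∑ i, Z i) ω - l * (1 - Real.exp (-b))⁻¹|} := by
    intro ω hω
    simp only [Set.mem_ofPred_eq] at hω ⊢
    have : (∑ i, Z i) ω - l * (1 - Real.exp (-b))⁻¹ =
        -(l * ((1 - Real.exp (-b))⁻¹ - (∑ i, (Y i ω : ℝ)) / l)) := by
      simp only [Finset.sum_apply, hZ]
      field_simp
      ring
    rw [this, abs_neg, abs_mul, abs_of_pos hl']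
    exact mul_le_mul_of_nonneg_left hω hl'.le
  have h2 : P.real {ω | l * s ≤ |(∑ i, Z i) ω - l * (1 - Real.exp (-b))⁻¹|} ≤
      variance (∑ i, Z i) P / (l * s) ^ 2 :=
    ENNReal.toReal_le_of_le_ofReal (div_nonneg (variance_nonneg _ _) (by positivity)) h1
  refine (measureReal_mono hset).trans (h2.trans ?_)
  calc variance (∑ i, Z i) P / (l * s) ^ 2 ≤ (l * (b ^ 2)⁻¹) / (l * s) ^ 2 := by gcongr
    _ = (l * (s ^ 2 * b ^ 2))⁻¹ := by field_simp
    _ ≤ (c ^ 2)⁻¹ := by gcongr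

/-- The tilting parameters scale like 1/√l, which makes both tail bounds depend on `c` only,
uniformly in `l ≥ 1`. -/
theorem chernoff_geometric (hY : ∀ i, IsGeometric (Y i) P b) (hb : 0 < b)
    (hind : iIndepFun Y P) (hl : 0 < l) {s c : ℝ} (hs : 0 < s) (hc : 0 < c)
    (hcs : c ^ 2 ≤ l * (s ^ 2 * b ^ 2)) :
    P.real {ω | s ≤ |(1 - Real.exp (-b))⁻¹ - (∑ i, (Y i ω : ℝ)) / l|} ≤
      Real.exp (Real.log 8 - 7 / 8 - 7 / 8 * c) + Real.exp (-(c ^ 2 / 2)) := by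
  have hl' : (1 : ℝ) ≤ l := by exact_mod_cast hl
  have hl0 : (0 : ℝ) < l := by linarith
  set μ := (1 - Real.exp (-b))⁻¹ with hμ
  set r := √(l : ℝ) with hr
  have hr1 : 1 ≤ r := Real.one_le_sqrt.2 hl'
  have hr0 : 0 < r := by linarith
  have hrr : r * r = l := Real.mul_self_sqrt hl0.le
  have hcr : c ≤ r * (s * b) := by
    refine (pow_le_pow_iff_left₀ hc.le (by positivity) two_ne_zero).1 (hcs.trans_eq ?_)
    rw [← hrr]
    ring
  have hset : {ω | s ≤ |μ - (∑ i, (Y i ω : ℝ)) / l|} ⊆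
      {ω | l * (μ + s) ≤ ∑ i, (Y i ω : ℝ)} ∪ {ω | ∑ i, (Y i ω : ℝ) ≤ l * (μ - s)} := by
    intro ω hω
    simp only [Set.mem_ofPred_eq, Set.mem_union] at hω ⊢
    have e : (∑ i, (Y i ω : ℝ)) = l * ((∑ i, (Y i ω : ℝ)) / l) := by field_simp
    rcases le_abs.1 hω with h | h
    · right
      rw [e]
      exact mul_le_mul_of_nonneg_left (by linarith) hl0.le
    · left
      rw [e]
      exact mul_le_mul_of_nonneg_left (by linarith) hl0.le
  refine (measureReal_mono hset).trans ((measureReal_union_le _ _).trans (add_le_add ?_ ?_))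
  · have ht1 : r⁻¹ ≤ 1 := inv_le_one_of_one_le₀ hr1
    have ht0 : 0 < r⁻¹ := by positivity
    have hx1 : r⁻¹ * (7 / 8) < 1 := by linarith
    obtain ⟨i1, i2⟩ := mgf_sum_geometric_le hY hb hind hx1
    have h3 := measure_ge_le_exp_mul_mgf (l * (μ + s)) (by positivity) i1
    refine h3.trans ((mul_le_mul_of_nonneg_left i2 (Real.exp_pos _).le).trans ?_)
    rw [← Real.exp_add, Real.exp_le_exp]
    have h4 := neg_log_one_sub_sub_le (x := 7 / 8) (t := r⁻¹) (by norm_num) (by norm_num)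
      ht0.le ht1
    have h5 : Real.log (1 - 7 / 8) = -Real.log 8 := by
      rw [← Real.log_inv]; norm_num
    rw [h5] at h4
    have h6 : l * (-(r⁻¹ * (7 / 8)) - Real.log (1 - r⁻¹ * (7 / 8))) ≤ Real.log 8 - 7 / 8 := by
      have := mul_le_mul_of_nonneg_left h4 hl0.le
      have e : (l : ℝ) * (r⁻¹ ^ 2 * (-(7 / 8) - -Real.log 8)) = Real.log 8 - 7 / 8 := by
        rw [← hrr]; field_simp; ring
      rwa [e] at this
    have h7 : (l : ℝ) * (r⁻¹ * (7 / 8) * b * s) = 7 / 8 * (r * (s * b)) := by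
      rw [← hrr]; field_simp
    nlinarith
  -- Lower tail with x = -c/√l: the linear term gives at most -c², the logarithmic one at most c²/2.
  · have hx0 : 0 ≤ c / r := by positivity
    obtain ⟨i1, i2⟩ := mgf_sum_geometric_le hY hb hind (x := -(c / r)) (by linarith)
    have h3 := measure_le_le_exp_mul_mgf (l * (μ - s)) (by nlinarith) i1
    refine h3.trans ((mul_le_mul_of_nonneg_left i2 (Real.exp_pos _).le).trans ?_)
    rw [← Real.exp_add, Real.exp_le_exp]
    have h4 := sub_log_one_add_le hx0
    have h6 : l * (- -(c / r) - Real.log (1 - -(c / r))) ≤ c ^ 2 / 2 := by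
      rw [neg_neg, sub_neg_eq_add]
      have := mul_le_mul_of_nonneg_left h4 hl0.le
      have e : (l : ℝ) * ((c / r) ^ 2 / 2) = c ^ 2 / 2 := by
        rw [← hrr]; field_simp
      rwa [e] at this
    have h7 : (l : ℝ) * (c / r * b * s) = c * (r * (s * b)) := by
      rw [← hrr]; field_simp
    nlinarith

end Concentration

/-! ### Degrees and the logarithmic factor -/

section Degrees

variable {V : Type*} [Fintype V] [DecidableEq V] {G : SimpleGraph V} [DecidableRel G.Adj] {v : V}

/-- Cauchy–Schwarz for the n - 1 degrees other than that of `v`. -/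
theorem two_mul_card_edgeFinset_sub_degree_le :
    2 * (G.edgeFinset.card : ℝ) - G.degree v ≤ √((Fintype.card V : ℝ) - 1) * degreeNorm G v := by
  have h1 : ∑ x : {x : V // x ≠ v}, (G.degree x.1 : ℝ) =
      2 * (G.edgeFinset.card : ℝ) - G.degree v := by
    have h := G.sum_degrees_eq_twice_card_edges
    have h2 : ∑ x, (G.degree x : ℝ) = 2 * (G.edgeFinset.card : ℝ) := by exact_mod_cast h
    rw [← h2, ← Fintype.sum_subtype_add_sum_subtype (fun k => k ≠ v)]
    have h3 : ∑ k : {k // ¬ k ≠ v}, (G.degree k.1 : ℝ) = G.degree v := by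
      have : Unique {k // ¬ k ≠ v} :=
        ⟨⟨⟨v, by simp⟩⟩, fun k => Subtype.ext (not_not.1 k.2)⟩
      rw [Fintype.sum_unique]
      exact congrArg (fun k => (G.degree k : ℝ)) (not_not.1 (default : {k // ¬ k ≠ v}).2)
    rw [h3]
    ring
  have hcard : ((Fintype.card {x : V // x ≠ v} : ℕ) : ℝ) = (Fintype.card V : ℝ) - 1 := by
    have h0 : 0 < Fintype.card V := Fintype.card_pos_iff.2 ⟨v⟩
    rw [Fintype.card_subtype_compl, Fintype.card_subtype_eq, Nat.cast_sub h0, Nat.cast_one]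
  have h2 := sq_sum_le_card_mul_sum_sq (s := Finset.univ)
    (f := fun x : {x : V // x ≠ v} => (G.degree x.1 : ℝ))
  rw [Finset.card_univ, hcard, h1] at h2
  rw [degreeNorm, EuclideanSpace.norm_eq, ← Real.sqrt_mul (by
    rw [← hcard]; exact Nat.cast_nonneg _)]
  refine Real.le_sqrt_of_sq_le (h2.trans_eq ?_)
  simp

theorem adj_eq_of_degree_eq (h : G.degree v = G.edgeFinset.card) {x y : V} (hx : x ≠ v)
    (hxy : G.Adj x y) : y = v := by
  have h1 : G.incidenceFinset v = G.edgeFinset :=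
    Finset.eq_of_subset_of_card_le (G.incidenceFinset_subset v)
      (by rw [G.card_incidenceFinset_eq_degree, h])
  have h2 : s(x, y) ∈ G.incidenceFinset v := by
    rw [h1, SimpleGraph.mem_edgeFinset]
    exact hxy
  rw [SimpleGraph.mem_incidenceFinset] at h2
  rcases Sym2.mem_iff.1 h2.2 with h3 | h3
  · exact absurd h3.symm hx
  · exact h3.symm

theorem degree_le_card_edgeFinset : G.degree v ≤ G.edgeFinset.card := by
  rw [← G.card_incidenceFinset_eq_degree]
  exact Finset.card_le_card (G.incidenceFinset_subset v)

/-- Every edge meets `v`, so a walk from `u` is absorbed at its first step. -/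
theorem greenMatrix_eq_one_of_degree_eq
    (h : G.degree v = G.edgeFinset.card) {u : V} (hu : u ≠ v) :
    greenMatrix (stepProb G) {v} u u = 1 := by
  have hz : ∑ x, stepProb G u x * greenSum (stepProb G) {v} {u} x = 0 := by
    refine Finset.sum_eq_zero fun x _ => ?_
    by_cases hux : G.Adj u x
    · have hx := adj_eq_of_degree_eq h hu hux
      rw [greenSum_eq]
      simp [hx, hu.symm]
    · simp [stepProb, hux]
  rw [greenMatrix, greenSum_eq, hz]
  simp

/-- The logarithmic factor is at least `log (n (m + 1) / m)` if some edge avoids the root. -/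
theorem log_le_abs_log_factor (hdeg : G.degree v + 1 ≤ G.edgeFinset.card) :
    Real.log (Fintype.card V * ((G.edgeFinset.card + 1) / G.edgeFinset.card)) ≤
      |Real.log (G.edgeFinset.card /
        (Fintype.card V * √((Fintype.card V : ℝ) - 1) * degreeNorm G v))| := by
  have hm : (0 : ℝ) < G.edgeFinset.card := by
    have : 0 < G.edgeFinset.card := by omega
    exact_mod_cast this
  have hn : (0 : ℝ) < Fintype.card V := by
    have : 0 < Fintype.card V := Fintype.card_pos_iff.2 ⟨v⟩
    exact_mod_cast this
  have hd : (G.degree v : ℝ) + 1 ≤ G.edgeFinset.card := by exact_mod_cast hdeg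
  have h1 := two_mul_card_edgeFinset_sub_degree_le (G := G) (v := v)
  -- After inverting the fraction, 2m - deg v ≥ m + 1 is all that is needed.
  refine le_trans ?_ (neg_le_abs _)
  rw [← Real.log_inv, inv_div]
  refine Real.log_le_log (by positivity) ?_
  rw [mul_div_assoc', mul_assoc]
  gcongr
  linarith

end Degrees

/-! ### Numerical estimates -/

/-- Rational lower bounds for logarithms, checked as an inequality between powers with a decimal
upper bound for e. -/
theorem div_le_log {a : ℝ} (ha : 0 < a) (p q : ℕ) (hq : 0 < q)
    (h : (2.7182818286 : ℝ) ^ p ≤ a ^ q) : (p : ℝ) / q ≤ Real.log a := by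
  have hq' : (0 : ℝ) < q := by exact_mod_cast hq
  rw [div_le_iff₀ hq', mul_comm, ← Real.log_pow, Real.le_log_iff_exp_le (by positivity)]
  rw [← mul_one (p : ℝ), Real.exp_nat_mul]
  exact (pow_le_pow_left₀ (Real.exp_pos _).le Real.exp_one_lt_d9.le p).trans h

theorem le_sq_mul_log_of_le {a x y K n bound : ℝ} (hx0 : 0 ≤ x) (hy0 : 0 ≤ y) (ha : 0 < a)
    (han : a ≤ n) (hnb : n ≤ bound) (hx : x ≤ Real.log a) (hy : y ≤ Real.log (2 * a))
    (hxy : bound ≤ x ^ 2 * y) (hK : Real.log n ≤ K) : n ≤ K ^ 2 * Real.log (2 * n) := by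
  have h1 : x ≤ K := hx.trans ((Real.log_le_log ha han).trans hK)
  have h2 : y ≤ Real.log (2 * n) := hy.trans (Real.log_le_log (by linarith) (by linarith))
  calc n ≤ x ^ 2 * y := hnb.trans hxy
    _ ≤ K ^ 2 * Real.log (2 * n) := by gcongr

/-- The Chebyshev range. From n = 5 on, K ≥ log n is enough, and monotonicity reduces each interval
to its left end. For n = 3, 4 it is not, and the factor (m + 1)/m with m ≤ C(n, 2) is used: the
arguments become 4 and 14/3. -/
theorem le_sq_mul_log {n m : ℕ} {K : ℝ} (hn3 : 3 ≤ n) (hn : n < 64) (hm : 0 < m)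
    (hmn : m ≤ n.choose 2) (hK : Real.log (n * ((m + 1) / m)) ≤ K) :
    (n : ℝ) ≤ K ^ 2 * Real.log (2 * n) := by
  have hm0 : (0 : ℝ) < m := by exact_mod_cast hm
  have hn0 : (0 : ℝ) < n := by exact_mod_cast (by omega : 0 < n)
  have hKn : Real.log n ≤ K := by
    refine le_trans (Real.log_le_log hn0 ?_) hK
    refine le_mul_of_one_le_right hn0.le ?_
    rw [one_le_div hm0]; linarith
  have aux : ∀ (a bound p q p' q' : ℕ), 0 < a → 0 < q → 0 < q' →
      (2.7182818286 : ℝ) ^ p ≤ (a : ℝ) ^ q → (2.7182818286 : ℝ) ^ p' ≤ (2 * a : ℝ) ^ q' →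
      (bound : ℝ) ≤ ((p : ℝ) / q) ^ 2 * ((p' : ℝ) / q') → a ≤ n → n ≤ bound →
      (n : ℝ) ≤ K ^ 2 * Real.log (2 * n) := by
    intro a bound p q p' q' ha hq hq' h1 h2 h3 h4 h5
    have ha0 : (0 : ℝ) < a := by exact_mod_cast ha
    exact le_sq_mul_log_of_le (by positivity) (by positivity) ha0 (by exact_mod_cast h4)
      (by exact_mod_cast h5) (div_le_log ha0 p q hq h1) (div_le_log (by linarith) p' q' hq' h2)
      h3 hKn
  have aux2 : ∀ (a x : ℝ), 0 < a → a ≤ n * ((m + 1) / m) → x ≤ Real.log a → x ≤ K :=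
    fun a x ha h1 h2 => h2.trans ((Real.log_le_log ha h1).trans hK)
  by_cases h5 : n < 5
  · interval_cases n
    · have hm3 : (m : ℝ) ≤ 3 := by exact_mod_cast hmn
      have h1 : (11 : ℕ) / (8 : ℕ) ≤ K := by
        refine aux2 4 _ (by norm_num) ?_ (div_le_log (by norm_num) 11 8 (by norm_num)
          (by norm_num))
        rw [mul_div_assoc', le_div_iff₀ hm0]
        push_cast
        linarith
      have h2 := div_le_log (a := 2 * (3 : ℕ)) (by norm_num) 7 4 (by norm_num) (by norm_num)
      have h3 : ((11 : ℕ) / (8 : ℕ) : ℝ) ^ 2 * ((7 : ℕ) / (4 : ℕ)) ≤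
          K ^ 2 * Real.log (2 * (3 : ℕ)) := by gcongr
      refine le_trans ?_ h3
      norm_num
    · have hm6 : (m : ℝ) ≤ 6 := by exact_mod_cast hmn
      have h1 : (3 : ℕ) / (2 : ℕ) ≤ K := by
        refine aux2 (14 / 3) _ (by norm_num) ?_ (div_le_log (by norm_num) 3 2 (by norm_num)
          (by norm_num))
        rw [mul_div_assoc', le_div_iff₀ hm0]
        push_cast
        linarith
      have h2 := div_le_log (a := 2 * (4 : ℕ)) (by norm_num) 2 1 (by norm_num) (by norm_num)
      have h3 : ((3 : ℕ) / (2 : ℕ) : ℝ) ^ 2 * ((2 : ℕ) / (1 : ℕ)) ≤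
          K ^ 2 * Real.log (2 * (4 : ℕ)) := by gcongr
      refine le_trans ?_ h3
      norm_num
  by_cases h6 : n < 6
  · exact aux 5 5 8 5 23 10 (by norm_num) (by norm_num) (by norm_num) (by norm_num) (by norm_num)
      (by norm_num) (by omega) (by omega)
  by_cases h8 : n < 8
  · exact aux 6 7 7 4 12 5 (by norm_num) (by norm_num) (by norm_num) (by norm_num) (by norm_num)
      (by norm_num) (by omega) (by omega)
  by_cases h12 : n < 12
  · exact aux 8 11 2 1 11 4 (by norm_num) (by norm_num) (by norm_num) (by norm_num) (by norm_num)
      (by norm_num) (by omega) (by omega)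
  by_cases h18 : n < 18
  · exact aux 12 17 12 5 3 1 (by norm_num) (by norm_num) (by norm_num) (by norm_num)
      (by norm_num) (by norm_num) (by omega) (by omega)
  by_cases h28 : n < 28
  · exact aux 18 27 14 5 7 2 (by norm_num) (by norm_num) (by norm_num) (by norm_num)
      (by norm_num) (by norm_num) (by omega) (by omega)
  by_cases h44 : n < 44
  · exact aux 28 43 33 10 4 1 (by norm_num) (by norm_num) (by norm_num) (by norm_num)
      (by norm_num) (by norm_num) (by omega) (by omega)
  by_cases h62 : n < 62
  · exact aux 44 61 15 4 22 5 (by norm_num) (by norm_num) (by norm_num) (by norm_num)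
      (by norm_num) (by norm_num) (by omega) (by omega)
  · exact aux 62 63 4 1 19 4 (by norm_num) (by norm_num) (by norm_num) (by norm_num)
      (by norm_num) (by norm_num) (by omega) (by omega)

/-- For n ≥ 64, log(2n) ≥ 4.8 gives c² ≥ 2.4 log² n, hence c ≥ 1.54 log n, and each of the two
exponentials is at most 1/n. -/
theorem chernoff_bound_le {n c K : ℝ} (hn : 64 ≤ n) (hK : Real.log n ≤ K) (hc : 0 ≤ c)
    (hcK : c ^ 2 = K ^ 2 * Real.log (2 * n) / 2) :
    Real.exp (Real.log 8 - 7 / 8 - 7 / 8 * c) + Real.exp (-(c ^ 2 / 2)) ≤ 2 / n := by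
  have hn0 : 0 < n := by linarith
  have hL : ((41 : ℕ) : ℝ) / (10 : ℕ) ≤ Real.log n :=
    (div_le_log (by norm_num) 41 10 (by norm_num) (by norm_num)).trans
      (Real.log_le_log (by norm_num : (0 : ℝ) < 64) hn)
  have hL2 : ((24 : ℕ) : ℝ) / (5 : ℕ) ≤ Real.log (2 * n) :=
    (div_le_log (by norm_num) 24 5 (by norm_num) (by norm_num)).trans
      (Real.log_le_log (by norm_num : (0 : ℝ) < 128) (by linarith))
  push_cast at hL hL2
  set L := Real.log n with hLdef
  have hL0 : 0 < L := by linarith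
  have h1 : 2.4 * L ^ 2 ≤ c ^ 2 := by
    have h2 : L ^ 2 ≤ K ^ 2 := pow_le_pow_left₀ hL0.le hK 2
    have h3 : L ^ 2 * (24 / 5) ≤ K ^ 2 * Real.log (2 * n) := by gcongr
    rw [hcK]
    linarith
  have h2 : 1.54 * L ≤ c := by
    refine (pow_le_pow_iff_left₀ (by positivity) hc two_ne_zero).1 ?_
    nlinarith
  have h8 : Real.log 8 ≤ 2.08 := by
    have : Real.log 8 = 3 * Real.log 2 := by
      rw [show (8 : ℝ) = 2 ^ 3 by norm_num, Real.log_pow]; norm_num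
    rw [this]
    linarith [Real.log_two_lt_d9]
  have he : Real.exp (-L) = 1 / n := by
    rw [Real.exp_neg, hLdef, Real.exp_log hn0, one_div]
  have e1 : Real.exp (Real.log 8 - 7 / 8 - 7 / 8 * c) ≤ 1 / n := by
    rw [← he, Real.exp_le_exp]
    nlinarith
  have e2 : Real.exp (-(c ^ 2 / 2)) ≤ 1 / n := by
    rw [← he, Real.exp_le_exp]
    nlinarith
  calc _ ≤ 1 / n + 1 / n := add_le_add e1 e2
    _ = 2 / n := by ring

end

end WilsonEstimator

theorem mainTheorem3 {V Ω : Type*} [Fintype V] [DecidableEq V]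
    [MeasurableSpace V] [DiscreteMeasurableSpace V] [MeasurableSpace Ω]
    (G : SimpleGraph V) [DecidableRel G.Adj] (hG : G.Connected) (v : V)
    (order : List V) (hnodup : order.Nodup) (horder : ∀ x, x ∈ order ↔ x ≠ v)
    (ε : ℝ) (hε : 0 < ε) (l : ℕ) (hl : 0 < l)
    (n m : ℝ) (hn : n = Fintype.card V) (hm : m = G.edgeFinset.card)
    (hsize : 2 * (ε ^ 2)⁻¹ * Real.log (2 * n) *
        Real.log (m / (n * √(n - 1) * WilsonEstimator.degreeNorm G v)) ^ 2 /
          Real.log (WilsonEstimator.trapEigenvalue G v) ^ 2 ≤ l)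
    (P : MeasureTheory.Measure Ω) [MeasureTheory.IsProbabilityMeasure P]
    (R : Fin l → V → ℕ → V → Ω → V) (hR : WilsonEstimator.IsUniformNeighborTable G P R)
    (u : {x : V // x ≠ v}) :
    P.real {ω | ε / 2 ≤
      |(WilsonEstimator.deleteNode (WilsonEstimator.normLaplacian G) v)⁻¹ u u -
        WilsonEstimator.averageVisits R v order u ω|} ≤ 2 / n := by
    open WilsonEstimator MeasureTheory ProbabilityTheory in
  have hp := isAbsorbing_stepProb hG u.2
  have hdeg := fun x => degree_pos_of_ne hG u.2 x
  have hcard : 2 ≤ Fintype.card V := Fintype.one_lt_card_iff.2 ⟨u.1, v, u.2⟩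
  have hn2 : 2 ≤ n := by rw [hn]; exact_mod_cast hcard
  have hlaw := measureReal_runVisits hG u.2 hnodup horder hR
  have hmeas := measurable_runVisits hR.measurable v order u.1
  obtain ⟨hlam0, hlam1, hlamg⟩ := greenMatrix_spectral_bound hp hdeg u
  have hg1 := one_le_greenMatrix (hp.greenSum_ne_top {v} (Finset.mem_singleton_self v)) u.1
  rw [inv_deleteNode_normLaplacian_apply hp hdeg]
  have havg : ∀ ω, averageVisits R v order u.1 ω =
      (∑ i, (runVisits R v order u.1 i ω : ℝ)) / l := fun _ => rfl
  simp_rw [havg]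
  -- The case g = 1 contains λ = 0, by g(1 - λ) ≤ 1, as well as the graphs all of whose edges meet
  -- `v`. Every run then visits `u` exactly once, almost surely.
  rcases hg1.eq_or_lt with hg | hg
  · have hae : ∀ i, ∀ᵐ ω ∂P, runVisits R v order u.1 i ω = 1 := by
      intro i
      have h1 : P.real (runVisits R v order u.1 i ⁻¹' {1}) = 1 := by
        rw [hlaw, ← hg]; simp
      refine (mem_ae_iff_prob_eq_one (hmeas i (measurableSet_singleton 1))).2 ?_
      rwa [measureReal_def, ENNReal.toReal_eq_one_iff] at h1
    have hz : P.real {ω | ε / 2 ≤ |greenMatrix (stepProb G) {v} u.1 u.1 -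
        (∑ i, (runVisits R v order u.1 i ω : ℝ)) / l|} = 0 := by
      rw [measureReal_eq_zero_iff]
      have hall : ∀ᵐ ω ∂P, ∀ i, runVisits R v order u.1 i ω = 1 := ae_all_iff.2 hae
      rw [measure_eq_zero_iff_ae_notMem]
      filter_upwards [hall] with ω hω1 hω
      have h2 : (∑ i, (runVisits R v order u.1 i ω : ℝ)) = l := by simp [hω1]
      have hl' : (l : ℝ) ≠ 0 := by exact_mod_cast hl.ne'
      have h3 : ε / 2 ≤ |greenMatrix (stepProb G) {v} u.1 u.1 -
        (∑ i, (runVisits R v order u.1 i ω : ℝ)) / l| := hω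
      rw [h2, ← hg, div_self hl', sub_self, abs_zero] at h3
      linarith
    rw [hz]
    positivity
  · set g := greenMatrix (stepProb G) {v} u.1 u.1 with hgdef
    have hg0 : 0 < g := by linarith
    have hq0 : 0 < 1 - g⁻¹ := by
      have := inv_lt_one_of_one_lt₀ hg
      linarith
    have hq1 : 1 - g⁻¹ < 1 := by
      have := inv_pos.2 hg0
      linarith
    set b := -Real.log (1 - g⁻¹) with hb
    have hb0 : 0 < b := neg_pos.2 (Real.log_neg hq0 hq1)
    have hexp : Real.exp (-b) = 1 - g⁻¹ := by rw [hb, neg_neg, Real.exp_log hq0]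
    have hginv : (1 - Real.exp (-b))⁻¹ = g := by rw [hexp, sub_sub_cancel, inv_inv]
    have hgeo : ∀ i, IsGeometric (runVisits R v order u.1 i) P b := fun i =>
      ⟨hmeas i, fun k => by rw [hlaw, hexp, sub_sub_cancel]⟩
    have hind := iIndepFun_runVisits hR v order u.1
    have hqlam : 1 - g⁻¹ ≤ trapEigenvalue G v := by
      have : 1 - trapEigenvalue G v ≤ g⁻¹ := by
        rw [le_inv_comm₀ (by linarith) hg0, ← one_div, le_div_iff₀ (by linarith)]
        exact hlamg
      linarith
    -- Since g > 1, some edge avoids `v`, which makes the bound on K available.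
    have hdegv : G.degree v + 1 ≤ G.edgeFinset.card := by
      refine Nat.lt_of_le_of_ne degree_le_card_edgeFinset fun h => ?_
      exact hg.ne' (greenMatrix_eq_one_of_degree_eq h u.2)
    have hK := log_le_abs_log_factor hdegv
    set K := |Real.log (G.edgeFinset.card /
      (Fintype.card V * √((Fintype.card V : ℝ) - 1) * degreeNorm G v))| with hKdef
    have hm0 : 0 < G.edgeFinset.card := by omega
    have hm0' : (0 : ℝ) < G.edgeFinset.card := by exact_mod_cast hm0
    have hKn : Real.log n ≤ K := by
      refine le_trans (Real.log_le_log (by linarith) ?_) hK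
      rw [← hn]
      refine le_mul_of_one_le_right (by linarith) ?_
      rw [one_le_div hm0']; linarith
    have hlogn : 0 < Real.log n := Real.log_pos (by linarith)
    have hlog2n : 0 < Real.log (2 * n) := Real.log_pos (by linarith)
    have hK0 : 0 < K := by linarith
    set c := √(K ^ 2 * Real.log (2 * n) / 2) with hcdef
    have hc2 : c ^ 2 = K ^ 2 * Real.log (2 * n) / 2 := Real.sq_sqrt (by positivity)
    have hc0 : 0 < c := Real.sqrt_pos.2 (by positivity)
    -- The sample size condition, with |log λ| ≤ b used to replace log² λ by b².
    have hcs : c ^ 2 ≤ l * ((ε / 2) ^ 2 * b ^ 2) := by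
      rw [hn, hm, ← sq_abs (Real.log (_ / _)), ← hKdef, ← hn] at hsize
      have hlampos : 0 < trapEigenvalue G v := hq0.trans_le hqlam
      have hlog : Real.log (trapEigenvalue G v) < 0 := Real.log_neg hlampos hlam1
      have hlogb : Real.log (trapEigenvalue G v) ^ 2 ≤ b ^ 2 := by
        rw [← neg_sq]
        refine pow_le_pow_left₀ (by linarith) ?_ 2
        rw [hb]
        exact neg_le_neg (Real.log_le_log hq0 hqlam)
      rw [div_le_iff₀ (sq_pos_of_ne_zero hlog.ne)] at hsize
      have h2 : 2 * (ε ^ 2)⁻¹ * Real.log (2 * n) * K ^ 2 ≤ l * b ^ 2 :=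
        hsize.trans (mul_le_mul_of_nonneg_left hlogb (Nat.cast_nonneg _))
      have h3 := mul_le_mul_of_nonneg_right h2 (by positivity : 0 ≤ ε ^ 2 / 4)
      have h4 : 2 * (ε ^ 2)⁻¹ * Real.log (2 * n) * K ^ 2 * (ε ^ 2 / 4) = c ^ 2 := by
        rw [hc2]; field_simp; ring
      rw [h4] at h3
      refine h3.trans_eq ?_
      ring
    rw [← hginv]
    rcases Nat.lt_or_ge (Fintype.card V) 3 with h3 | h3
    · have : n = 2 := by
        rw [hn]; exact_mod_cast (by omega : Fintype.card V = 2)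
      rw [this]
      exact measureReal_le_one.trans (by norm_num)
    rcases Nat.lt_or_ge (Fintype.card V) 64 with h64 | h64
    · refine (chebyshev_geometric hgeo hb0 hind hl (half_pos hε) hc0 hcs).trans ?_
      have h5 := le_sq_mul_log h3 h64 hm0 G.card_edgeFinset_le_card_choose_two hK
      rw [← hn] at h5
      have h6 : n / 2 ≤ c ^ 2 := by rw [hc2]; linarith
      rw [← inv_div]
      exact inv_anti₀ (by linarith) h6
    · refine (chernoff_geometric hgeo hb0 hind hl (half_pos hε) hc0 hcs).trans ?_
      exact chernoff_bound_le (by rw [hn]; exact_mod_cast h64) hKn hc0.le hc2
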